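/- Let $K$ be an algebraically closed field of characteristic different from $2$. For $n\ge 1$ let $\sigma$ be the involution $\sigma(g)=\mathscr J\,{}^tg^{-1}\mathscr J^{-1}$ of $\mathrm{GL}_n=\mathrm{GL}_n(K)$, where $\mathscr J$ is the antidiagonal matrix whose antidiagonal entries are all $1$, except that for $n$ even the entries in the last $n/2$ rows are $-1$. (For $n=1$ this is $\sigma(g)=g^{-1}$, and for $n=2$ it is $\sigma(g)=g/\det g$.) Let $\mathrm{GL}_n\langle\sigma\rangle=\mathrm{GL}_n\rtimes\langle\sigma\rangle$, the factor $\langle\sigma\rangle$ being of order $2$. Let $g\ge 0$ and $k\ge 1$ be integers. For a $2k$-tuple $\mathcal C=(C_j)_{1\le j\le 2k}$ of semisimple $\mathrm{GL}_n$-conjugacy classes contained in $\mathrm{GL}_n\sigma$ put $$\mathrm{Rep}_{\mathcal C}=\Big\{(A_i,B_i)_i(X_j)_j\in \mathrm{GL}_n^{2g}\times\prod_{j=1}^{2k}C_j \;\Big|\; \prod_{i=1}^g[A_i,B_i]\prod_{j=1}^{2k}X_j=1\Big\},\qquad \mathrm{Ch}_{\mathcal C}=\mathrm{Rep}_{\mathcal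 C}/\!/\mathrm{GL}_n ,$$ where $\mathrm{GL}_n$ acts by conjugation and $/\!/$ denotes the categorical quotient, that is, the spectrum over $K$ of the ring of invariant regular functions. **(a) The case $n=2$.** Assume that $a^2\neq -1$ for all $j$ and all $a\in K^\times$ with $\mathrm{diag}(a,a^{-1})\sigma\in C_j$. Then there are $\mathrm{SL}_2$-conjugacy classes $\mathcal C'=(C'_j)_{1\le j\le 2k}$ in $\mathrm{SL}_2$ such that, for every $j$, the inverse image of $C_j$ under $\mathbb G_m\times \mathrm{SL}_2\to \mathrm{GL}_2\sigma$, $(t,s)\mapsto ts\sigma$, equals $(\mathbb G_m\times C'_j)\cup(\mathbb G_m\times -C'_j)$. For every such tuple $\mathcal C'$ each of these unions is disjoint, and, with $$\mathrm{Rep}^{\pm}_{\mathcal C'}=\Big\{(A_i,B_i)_i(X'_j)_j\in \mathrm{GL}_2^{2g}\times\prod_{j=1}^{2k}C'_j \;\Big|\; \prod_{i=1}^g[A_i,B_i]\prod_{j=1}^{2k}X'_j=\pm1\Big\},\qquad \mathrm{Ch}^{\pm}_{\mathcal C'}=\mathrm{Rep}^{\pm}_{\mathcal C'}/\!/\mathrm{GL}_2,$$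 there is an isomorphism of $K$-schemes $$(\mathrm{Ch}^+_{\mathcal C'}\sqcup \mathrm{Ch}^-_{\mathcal C'})\times\mathbb G_m^{2k-2}\;\cong\;\mathrm{Ch}_{\mathcal C}.$$ It can be chosen so that, whenever $(A_i,B_i)_i(X'_j)_j\in\mathrm{Rep}^{\pm}_{\mathcal C'}$ and $t_j\in K^\times$ are such that $(A_i,B_i)_i(t_jX'_j\sigma)_j\in\mathrm{Rep}_{\mathcal C}$, the point of $\mathrm{Ch}_{\mathcal C}$ defined by $(A_i,B_i)_i(t_jX'_j\sigma)_j$ corresponds to a point of the left-hand side whose first component is the point of $\mathrm{Ch}^{\pm}_{\mathcal C'}$ defined by $(A_i,B_i)_i(X'_j)_j$. **(b) The case $n=1$.** Every $C_j$ is equal to $\mathrm{GL}_1\sigma$, and there is an isomorphism of $K$-schemes $\mathrm{Ch}_{\mathcal C}\cong\mathbb G_m^{2(g+k-1)}$. -/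

import Mathlib

open CategoryTheory CategoryTheory.Limits AlgebraicGeometry

noncomputable section

namespace CharVar

section Group

variable {K : Type*} [Field K] {n : ℕ}

/-- The signs in the matrix `𝒥`: if `n` is even the last `n / 2` rows carry the sign `-1`;
if `n` is odd there are no signs. -/
def jSign (K : Type*) [Field K] (n : ℕ) (i : Fin n) : K :=
  if Even n ∧ n / 2 ≤ (i : ℕ) then -1 else 1

/-- The matrix `𝒥`: antidiagonal, with signs (so antisymmetric) if `n` is even, and with all
antidiagonal entries equal to `1` if `n` is odd. -/
def jMatrix (K : Type*) [Field K] (n : ℕ) : Matrix (Fin n) (Fin n) K :=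
  Matrix.of fun i j => if j = i.rev then jSign K n i else 0

/-- The global sign in `𝒥ᵀ = ± 𝒥`. -/
def jEps (K : Type*) [Field K] (n : ℕ) : K := if Even n then -1 else 1

theorem jSign_mul_self (i : Fin n) : jSign K n i * jSign K n i = 1 := by
  unfold jSign; split_ifs <;> simp

theorem jEps_mul_self : jEps K n * jEps K n = 1 := by
  unfold jEps; split_ifs <;> simp

theorem jSign_rev (i : Fin n) : jSign K n i.rev = jEps K n * jSign K n i := by
  unfold jSign jEps
  have hi := i.isLt
  by_cases he : Even n
  · obtain ⟨r, hr⟩ := he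
    have he : Even n := ⟨r, hr⟩
    by_cases h : n / 2 ≤ (i : ℕ)
    · have h' : ¬ n / 2 ≤ ((i.rev : Fin n) : ℕ) := by rw [Fin.val_rev]; omega
      rw [if_neg (fun c => h' c.2), if_pos he, if_pos ⟨he, h⟩]; ring
    · have h' : n / 2 ≤ ((i.rev : Fin n) : ℕ) := by rw [Fin.val_rev]; omega
      rw [if_pos ⟨he, h'⟩, if_pos he, if_neg (fun c => h c.2)]; ring
  · simp [he]

theorem jMatrix_mul_transpose : jMatrix K n * (jMatrix K n).transpose = 1 := by
  ext i k
  simp only [Matrix.mul_apply, jMatrix, Matrix.transpose_apply, Matrix.of_apply, ite_mul, zero_mul,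
    Finset.sum_ite_eq', Finset.mem_univ, if_true, Matrix.one_apply]
  by_cases h : i = k
  · subst h; simp [jSign_mul_self]
  · have : ¬ i.rev = k.rev := fun h' => h (Fin.rev_injective h')
    simp [h, this]

theorem jMatrix_transpose : (jMatrix K n).transpose = jEps K n • jMatrix K n := by
  ext i k
  simp only [jMatrix, Matrix.transpose_apply, Matrix.of_apply, Matrix.smul_apply, smul_eq_mul]
  by_cases h : k = i.rev
  · subst h; simp [jSign_rev]
  · have : ¬ i = k.rev := fun h' => h (by rw [h', Fin.rev_rev])
    simp [h, this]

/-- `𝒥` as an invertible matrix. -/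
def jGL (K : Type*) [Field K] (n : ℕ) : GL (Fin n) K :=
  ⟨jMatrix K n, (jMatrix K n).transpose, jMatrix_mul_transpose,
    mul_eq_one_comm.mp jMatrix_mul_transpose⟩

/-- The inverse transpose `g ↦ g⁻ᵀ`. -/
def invTranspose : GL (Fin n) K →* GL (Fin n) K where
  toFun g := ⟨((g⁻¹ : GL (Fin n) K) : Matrix (Fin n) (Fin n) K).transpose,
    (g : Matrix (Fin n) (Fin n) K).transpose,
    by rw [← Matrix.transpose_mul, ← Units.val_mul]; simp,
    by rw [← Matrix.transpose_mul, ← Units.val_mul]; simp⟩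
  map_one' := by apply Units.ext; simp
  map_mul' a b := by
    apply Units.ext
    simp only [mul_inv_rev, Units.val_mul, Matrix.transpose_mul]

theorem invTranspose_invTranspose (g : GL (Fin n) K) : invTranspose (invTranspose g) = g := by
  apply Units.ext
  change (((g : Matrix (Fin n) (Fin n) K).transpose)).transpose = _
  simp

theorem invTranspose_jGL : invTranspose (jGL K n) = jGL K n := by
  apply Units.ext
  change ((jMatrix K n).transpose).transpose = jMatrix K n
  simp

theorem jGL_sq_comm (g : GL (Fin n) K) :
    jGL K n * jGL K n * g = g * (jGL K n * jGL K n) := by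
  have h : ((jGL K n * jGL K n : GL (Fin n) K) : Matrix (Fin n) (Fin n) K) =
      jEps K n • (1 : Matrix (Fin n) (Fin n) K) := by
    have h1 := jMatrix_mul_transpose (K := K) (n := n)
    rw [jMatrix_transpose, Matrix.mul_smul] at h1
    change jMatrix K n * jMatrix K n = _
    rw [← h1, smul_smul, jEps_mul_self, one_smul]
  apply Units.ext
  rw [Units.val_mul, Units.val_mul g, h]
  simp

/-- The map `g ↦ 𝒥 g⁻ᵀ 𝒥⁻¹`. -/
def sigmaHom : GL (Fin n) K →* GL (Fin n) K where
  toFun g := jGL K n * invTranspose g * (jGL K n)⁻¹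
  map_one' := by simp
  map_mul' a b := by simp [mul_assoc]

theorem sigmaHom_sigmaHom (g : GL (Fin n) K) : sigmaHom (sigmaHom g) = g := by
  change jGL K n * invTranspose (jGL K n * invTranspose g * (jGL K n)⁻¹) * (jGL K n)⁻¹ = g
  rw [map_mul, map_mul, map_inv, invTranspose_jGL, invTranspose_invTranspose]
  have := jGL_sq_comm (K := K) g
  calc _ = (jGL K n * jGL K n * g) * ((jGL K n)⁻¹ * (jGL K n)⁻¹) := by group
    _ = g := by rw [this]; group

/-- The exterior involution `σ(g) = 𝒥 g⁻ᵀ 𝒥⁻¹` of `GL_n`. -/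
def sigmaAut (K : Type*) [Field K] (n : ℕ) : MulAut (GL (Fin n) K) :=
  { sigmaHom with
    invFun := sigmaHom
    left_inv := sigmaHom_sigmaHom
    right_inv := sigmaHom_sigmaHom }

theorem sigmaAut_mul_self : sigmaAut K n * sigmaAut K n = 1 := by
  ext1 g
  exact sigmaHom_sigmaHom g

/-- The action of the group with two elements on `GL_n` through `σ`. -/
def sigmaAction (K : Type*) [Field K] (n : ℕ) :
    Multiplicative (ZMod 2) →* MulAut (GL (Fin n) K) where
  toFun e := if e = 1 then 1 else sigmaAut K n
  map_one' := by simp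
  map_mul' a b := by
    have key : ∀ e : Multiplicative (ZMod 2), e = 1 ∨ e = Multiplicative.ofAdd 1 := by decide
    have h1 : ¬ (Multiplicative.ofAdd (1 : ZMod 2) = 1) := by decide
    have h2 : (Multiplicative.ofAdd (1 : ZMod 2)) * Multiplicative.ofAdd (1 : ZMod 2) = 1 := by
      decide
    rcases key a with rfl | rfl <;> rcases key b with rfl | rfl <;>
      simp only [h1, h2, sigmaAut_mul_self, if_true, if_false, one_mul, mul_one]

/-- The group `GL_n⟨σ⟩ = GL_n ⋊ ⟨σ⟩`. -/
abbrev GLSigma (K : Type*) [Field K] (n : ℕ) : Type _ :=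
  GL (Fin n) K ⋊[sigmaAction K n] Multiplicative (ZMod 2)

/-- The inclusion `GL_n → GL_n⟨σ⟩` of the identity component. -/
abbrev incl (K : Type*) [Field K] (n : ℕ) : GL (Fin n) K →* GLSigma K n :=
  SemidirectProduct.inl

/-- The element `σ` of `GL_n⟨σ⟩`. -/
def sigmaElt (K : Type*) [Field K] (n : ℕ) : GLSigma K n :=
  SemidirectProduct.inr (Multiplicative.ofAdd 1)

/-- The connected component `GL_n σ` of `GL_n⟨σ⟩`. -/
def outerComponent (K : Type*) [Field K] (n : ℕ) : Set (GLSigma K n) :=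
  {x | ∃ h : GL (Fin n) K, x = incl K n h * sigmaElt K n}

/-- The standard faithful representation of `GL_n⟨σ⟩` on `K^n ⊕ K^n`: an element `h` of `GL_n`
acts as `h ⊕ σ(h)`, and `σ` exchanges the two summands. -/
def faithfulRep (K : Type*) [Field K] (n : ℕ) :
    GLSigma K n →* Matrix (Fin n ⊕ Fin n) (Fin n ⊕ Fin n) K where
  toFun x :=
    if x.right = 1 then Matrix.fromBlocks x.left.1 0 0 (sigmaAut K n x.left).1
    else Matrix.fromBlocks 0 x.left.1 (sigmaAut K n x.left).1 0
  map_one' := by simp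
  map_mul' x y := by
    have key : ∀ e : Multiplicative (ZMod 2), e = 1 ∨ e = Multiplicative.ofAdd 1 := by decide
    have h1 : ¬ (Multiplicative.ofAdd (1 : ZMod 2) = 1) := by decide
    have h2 : (Multiplicative.ofAdd (1 : ZMod 2)) * Multiplicative.ofAdd (1 : ZMod 2) = 1 := by
      decide
    have h3 : ∀ g : GL (Fin n) K, sigmaAut K n (sigmaAut K n g) = g := sigmaHom_sigmaHom
    rw [SemidirectProduct.mul_left, SemidirectProduct.mul_right]
    rcases key x.right with hx | hx <;> rcases key y.right with hy | hy <;>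
      simp [hx, hy, h1, h2, h3, sigmaAction, Matrix.fromBlocks_multiply]

/-- An element of the linear algebraic group `GL_n⟨σ⟩` is semisimple if it acts semisimply in the
standard faithful representation. -/
def IsSemisimpleElt (x : GLSigma K n) : Prop :=
  Module.End.IsSemisimple (Matrix.toLin' (faithfulRep K n x))

/-- `C` is a semisimple `GL_n`-conjugacy class contained in `GL_n σ`. -/
def IsSemisimpleOuterClass (C : Set (GLSigma K n)) : Prop :=
  ∃ x ∈ outerComponent K n, IsSemisimpleElt x ∧
    C = {y | ∃ h : GL (Fin n) K, y = incl K n h * x * (incl K n h)⁻¹}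

/-- The element `t • h` of `GL_n`, for a scalar `t` and `h ∈ GL_n`. -/
def scale (t : Kˣ) (h : GL (Fin n) K) : GL (Fin n) K :=
  Units.map (algebraMap K (Matrix (Fin n) (Fin n) K)).toMonoidHom t * h

/-- The element `diag(a, a⁻¹)` of `SL_2`. -/
def diagSL (a : Kˣ) : Matrix.SpecialLinearGroup (Fin 2) K :=
  ⟨!![(a : K), 0; 0, ((a⁻¹ : Kˣ) : K)], by simp [Matrix.det_fin_two]⟩

/-- The `SL_2`-conjugacy class `C'` gives the class `C ⊆ GL_2 σ`: the inverse image of `C` under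
the double covering `𝔾ₘ × SL_2 → GL_2 σ`, `(t, s) ↦ t s σ`, is the union of `𝔾ₘ × C'` and
`𝔾ₘ × (-C')`. -/
def IsLift (C : Set (GLSigma K 2)) (C' : Set (Matrix.SpecialLinearGroup (Fin 2) K)) : Prop :=
  (∃ s, C' = {s' | ∃ u, s' = u * s * u⁻¹}) ∧
  {p : Kˣ × Matrix.SpecialLinearGroup (Fin 2) K |
      incl K 2 (scale p.1 (p.2 : GL (Fin 2) K)) * sigmaElt K 2 ∈ C} =
    {p | p.2 ∈ C'} ∪ {p | -p.2 ∈ C'}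

end Group

section Variety

universe u

variable {K : Type u} [Field K] {n g m : ℕ} {H : Type u} [Group H]

/-- The tuples `((A_i, B_i)_i, (X_j)_j)`, with `A_i`, `B_i` in `GL_n` and `X_j` in the group `H`
(which will be `GL_n` or `GL_n⟨σ⟩`). -/
abbrev Tuples (K : Type u) [Field K] (n g m : ℕ) (H : Type u) : Type u :=
  (Fin g → GL (Fin n) K × GL (Fin n) K) × (Fin m → H)

/-- The set of tuples with `X_j ∈ C_j` for all `j` and `∏ [A_i, B_i] ∏ X_j = z`, where `GL_n` is
mapped to `H` by `ι`. -/
def repSet (g : ℕ) (ι : GL (Fin n) K →* H) (C : Fin m → Set H) (z : H) :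
    Set (Tuples K n g m H) :=
  {x | (∀ j, x.2 j ∈ C j) ∧
    ι (List.ofFn fun i => (x.1 i).1 * (x.1 i).2 * (x.1 i).1⁻¹ * (x.1 i).2⁻¹).prod * (List.ofFn x.2).prod = z}

/-- The conjugation action of `GL_n` on tuples. -/
def conjTuple (ι : GL (Fin n) K →* H) (h : GL (Fin n) K) (x : Tuples K n g m H) :
    Tuples K n g m H :=
  (fun i => (h * (x.1 i).1 * h⁻¹, h * (x.1 i).2 * h⁻¹), fun j => ι h * x.2 j * (ι h)⁻¹)

/-- The invertible matrices that make up a tuple, where `c` sends an element of `H` to the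
invertible matrix that represents it. -/
def tupleMatrix (c : H → GL (Fin n) K) (x : Tuples K n g m H) :
    Fin g ⊕ Fin g ⊕ Fin m → GL (Fin n) K
  | .inl i => (x.1 i).1
  | .inr (.inl i) => (x.1 i).2
  | .inr (.inr j) => c (x.2 j)

/-- The algebra of regular functions on a (Zariski closed) set `V` of tuples: the functions
`V → K` that are polynomials in the entries of the matrices of the tuple and of their inverses. -/
def regularFunctions (c : H → GL (Fin n) K) (V : Set (Tuples K n g m H)) :
    Subalgebra K (V → K) :=
  Algebra.adjoin K {f | ∃ r a b,
    f = (fun x => (tupleMatrix c x.1 r : Matrix (Fin n) (Fin n) K) a b) ∨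
    f = (fun x => (((tupleMatrix c x.1 r)⁻¹ : GL (Fin n) K) : Matrix (Fin n) (Fin n) K) a b)}

/-- The functions on `V` that are invariant under the conjugation action of `GL_n`. -/
def invariantFunctions (ι : GL (Fin n) K →* H) (V : Set (Tuples K n g m H)) :
    Subalgebra K (V → K) where
  carrier := {f | ∀ (h : GL (Fin n) K) (x y : V), y.1 = conjTuple ι h x.1 → f y = f x}
  mul_mem' ha hb h x y e := by simp [ha h x y e, hb h x y e]
  add_mem' ha hb h x y e := by simp [ha h x y e, hb h x y e]
  algebraMap_mem' _ _ _ _ _ := rfl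

/-- The ring of `GL_n`-invariant regular functions on `V`. -/
def invariantRing (ι : GL (Fin n) K →* H) (c : H → GL (Fin n) K) (V : Set (Tuples K n g m H)) :
    Subalgebra K (V → K) :=
  regularFunctions c V ⊓ invariantFunctions ι V

/-- The spectrum of a `K`-algebra as a scheme over `K`. -/
def specOver (K : Type u) [Field K] (A : Type u) [CommRing A] [Algebra K A] :
    Over (Spec (.of K)) :=
  Over.mk (Spec.map (CommRingCat.ofHom (algebraMap K A)))

/-- The categorical quotient `V // GL_n`: the spectrum of the ring of invariants. -/
def quotientVariety (ι : GL (Fin n) K →* H) (c : H → GL (Fin n) K)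
    (V : Set (Tuples K n g m H)) : Over (Spec (.of K)) :=
  specOver K (invariantRing ι c V)

/-- The image in `V // GL_n` of a point of `V`, as a `K`-point. -/
def quotientPoint (ι : GL (Fin n) K →* H) (c : H → GL (Fin n) K)
    (V : Set (Tuples K n g m H)) (x : V) : Spec (.of K) ⟶ (quotientVariety ι c V).left :=
  Spec.map (CommRingCat.ofHom
    ((Pi.evalRingHom (fun _ : V => K) x).comp (invariantRing ι c V).val.toRingHom))

/-- The `GL_n⟨σ⟩`-representation variety `Rep_𝒞`: tuples with `X_j ∈ C_j ⊆ GL_n⟨σ⟩` and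
`∏ [A_i, B_i] ∏ X_j = 1`. -/
def RepSigma (g : ℕ) (C : Fin m → Set (GLSigma K n)) : Set (Tuples K n g m (GLSigma K n)) :=
  repSet g (incl K n) C 1

/-- The `GL_n⟨σ⟩`-character variety `Ch_𝒞 = Rep_𝒞 // GL_n`. An element `X σ` of `GL_n σ` has the
matrix `X`. -/
def ChSigma (g : ℕ) (C : Fin m → Set (GLSigma K n)) : Over (Spec (.of K)) :=
  quotientVariety (incl K n) SemidirectProduct.left (RepSigma g C)

/-- The `K`-point of `Ch_𝒞` given by an element of `Rep_𝒞`. -/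
def ChSigma.point {g : ℕ} {C : Fin m → Set (GLSigma K n)} (x : RepSigma g C) :
    Spec (.of K) ⟶ (ChSigma g C).left :=
  quotientPoint (incl K n) SemidirectProduct.left (RepSigma g C) x

/-- The `GL_n`-representation variety of tuples with `X_j ∈ C'_j ⊆ GL_n` and
`∏ [A_i, B_i] ∏ X_j = z`. -/
def RepGL (g : ℕ) (C' : Fin m → Set (GL (Fin n) K)) (z : GL (Fin n) K) :
    Set (Tuples K n g m (GL (Fin n) K)) :=
  repSet g (MonoidHom.id _) C' z

/-- The corresponding `GL_n`-character variety. -/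
def ChGL (g : ℕ) (C' : Fin m → Set (GL (Fin n) K)) (z : GL (Fin n) K) : Over (Spec (.of K)) :=
  quotientVariety (MonoidHom.id _) id (RepGL g C' z)

/-- The `K`-point of the `GL_n`-character variety given by an element of the representation
variety. -/
def ChGL.point {g : ℕ} {C' : Fin m → Set (GL (Fin n) K)} {z : GL (Fin n) K} (x : RepGL g C' z) :
    Spec (.of K) ⟶ (ChGL g C' z).left :=
  quotientPoint (MonoidHom.id _) id (RepGL g C' z) x

/-- A set of elements of `SL_2`, regarded as a set of elements of `GL_2`. -/
def toGLSet {K : Type u} [Field K] (C' : Set (Matrix.SpecialLinearGroup (Fin 2) K)) : Set (GL (Fin 2) K) :=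
  Matrix.SpecialLinearGroup.toGL '' C'

/-- The split torus `𝔾ₘ^d` over `K`: the spectrum of the Laurent polynomial ring in `d` variables,
that is, of the group algebra of `ℤ^d`. -/
def torus (K : Type u) [Field K] (d : ℕ) : Over (Spec (.of K)) :=
  specOver K (AddMonoidAlgebra K (Fin d → ℤ))

/-- The product `X × Y` of schemes over `S`. -/
def prodOver {S : Scheme.{u}} (X Y : Over S) : Over S :=
  Over.mk (pullback.fst X.hom Y.hom ≫ X.hom)

/-- The disjoint union `X ⊔ Y` of schemes over `S`. -/
def sumOver {S : Scheme.{u}} (X Y : Over S) : Over S :=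
  Over.mk (coprod.desc X.hom Y.hom)

end Variety

end CharVar

end

open CharVar

/-! The mechanism is that `σ` inverts scalars and, for `n = 2`, fixes `SL_2`. Let `n = 2`. A trace
zero element of `SL_2` is conjugate to `diag(i, -i)`, so the hypothesis on `C_j` says that the
constant trace `τ_j` of `C'_j` is nonzero. Hence each `X ∈ C_j` is `t s σ` with unique `t ∈ K^×` and
`s ∈ C'_j` (`exists_eq`, `scale_coe_injective`), and `t = tr / τ_j` is a regular function of the
matrix of `X`.

Moving all the `σ` to the right turns the relation into `(t_0 t_1⁻¹ t_2 ⋯) ∏ [A_i, B_i] ∏ s_j = 1`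
(`totalProd_incl_scale`). Taking determinants, the alternating product of the `t_j` is a sign, so
`((A_i, B_i), (s_j))` lies in `Rep^+` or `Rep^-`. Conjugation by `h` conjugates `A_i`, `B_i`, `s_j`
and multiplies every `t_j` by `det h`. In particular a scalar `z` moves only the `t_j`, by the
common factor `z²`. As `K` has square roots, every orbit meets the slice `t_0 = 1`; there the last
`t_j` is determined by the relation, and the other `2k - 2` are free. So the invariant ring of
`Rep_𝒞` is the ring of Laurent polynomials in the ratios `t_j / t_0` over the invariant ring of
`Rep^+ ∪ Rep^-` (`exists_laurent_algEquiv`, `exists_laurent_algEquiv_invariantRing`). The sign is an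
invariant regular function and, as `2 ≠ 0`, it splits the latter ring into a product
(`exists_invariantRing_RepPM_algEquiv`). Taking spectra gives the isomorphism; it respects points
because it is the evident map on coefficients.

For `n = 1` the same slice is used. All matrices are scalars, commutators vanish, and the base of
the Laurent ring is `K`, with the `A_i` and `B_i` as additional free coordinates. -/

/-! ### Spectra of products and tensor products of `K`-algebras -/

section Scheme

universe u

variable {K : Type u} [Field K]

theorem specOver_iso_of_algEquiv {A B : Type u} [CommRing A] [Algebra K A] [CommRing B]
    [Algebra K B] (e : A ≃ₐ[K] B) : Nonempty (specOver K A ≅ specOver K B) := by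
  refine ⟨Over.isoMk (Scheme.Spec.mapIso e.symm.toCommRingCatIso.op) ?_⟩
  change Spec.map _ ≫ Spec.map _ = Spec.map _
  rw [← Spec.map_comp]
  congr 1
  ext x
  exact e.symm.commutes x

/-- The structure morphism of the spectrum of a `K`-algebra. -/
noncomputable abbrev structMap (K : Type u) [Field K] (A : Type u) [CommRing A] [Algebra K A] :
    Spec (.of A) ⟶ Spec (.of K) :=
  Spec.map (CommRingCat.ofHom (algebraMap K A))

section

variable (R₁ R₂ T : Type u) [CommRing R₁] [Algebra K R₁] [CommRing R₂] [Algebra K R₂] [CommRing T]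
  [Algebra K T]

theorem coprodSpec_comp_structMap :
    coprodSpec R₁ R₂ ≫ structMap K (R₁ × R₂) =
      coprod.desc (structMap K R₁) (structMap K R₂) := by
  apply coprod.hom_ext
  · rw [coprodSpec_inl_assoc, coprod.inl_desc, ← Spec.map_comp]
    rfl
  · rw [coprodSpec_inr_assoc, coprod.inr_desc, ← Spec.map_comp]
    rfl

open TensorProduct in
-- Since `coprodSpec` is an isomorphism, this is the affine fibre product up to replacing `Spec R₁ ⨿
-- Spec R₂` by `Spec (R₁ × R₂)`. The formula for the first projection is what later identifies the
-- images of points.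
theorem exists_spec_tensor_iso :
    ∃ φ : Spec (.of ((R₁ × R₂) ⊗[K] T)) ≅
        pullback (coprod.desc (structMap K R₁) (structMap K R₂)) (structMap K T),
      φ.hom ≫ pullback.fst _ _ ≫ coprodSpec R₁ R₂ =
        Spec.map (CommRingCat.ofHom Algebra.TensorProduct.includeLeftRingHom) := by
  let f := pullback.map (coprod.desc (structMap K R₁) (structMap K R₂))
    (structMap K T) (structMap K (R₁ × R₂)) (structMap K T) (coprodSpec R₁ R₂) (𝟙 _) (𝟙 _)
    (by rw [coprodSpec_comp_structMap, Category.comp_id])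
    (by rw [Category.comp_id, Category.id_comp])
  have hf : f ≫ pullback.fst _ _ = pullback.fst _ _ ≫ coprodSpec R₁ R₂ := pullback.lift_fst _ _ _
  refine ⟨(pullbackSpecIso K (R₁ × R₂) T).symm ≪≫ (asIso f).symm, ?_⟩
  rw [Iso.trans_hom, Category.assoc, ← hf, Iso.symm_hom, Iso.symm_hom, asIso_inv,
    IsIso.inv_hom_id_assoc, pullbackSpecIso_inv_fst]

end

open TensorProduct in
/-- If `B` is the tensor product of `R₁ × R₂` and `T`, then `Spec B` is the product of
`Spec R₁ ⊔ Spec R₂` and `Spec T`. -/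
theorem exists_prodOver_sumOver_iso {R₁ R₂ T B : Type u} [CommRing R₁] [Algebra K R₁] [CommRing R₂]
    [Algebra K R₂] [CommRing T] [Algebra K T] [CommRing B] [Algebra K B]
    (e : (R₁ × R₂) ⊗[K] T ≃ₐ[K] B) :
    ∃ Φ : prodOver (sumOver (specOver K R₁) (specOver K R₂)) (specOver K T) ≅ specOver K B,
      Φ.inv.left ≫ pullback.fst _ _ ≫ coprodSpec R₁ R₂ =
        Spec.map (CommRingCat.ofHom
          ((e : (R₁ × R₂) ⊗[K] T →+* B).comp Algebra.TensorProduct.includeLeftRingHom)) := by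
  obtain ⟨φ, hφ⟩ := exists_spec_tensor_iso (K := K) R₁ R₂ T
  let ε : Spec (.of B) ≅ Spec (.of ((R₁ × R₂) ⊗[K] T)) :=
    Scheme.Spec.mapIso e.toCommRingCatIso.op
  have hε : ε.hom = Spec.map (CommRingCat.ofHom (e : (R₁ × R₂) ⊗[K] T →+* B)) := rfl
  have key : (ε ≪≫ φ).hom ≫ pullback.fst _ _ ≫ coprodSpec R₁ R₂ = Spec.map (CommRingCat.ofHom
      ((e : (R₁ × R₂) ⊗[K] T →+* B).comp Algebra.TensorProduct.includeLeftRingHom)) := by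
    rw [Iso.trans_hom, Category.assoc, hφ, hε, ← Spec.map_comp]
    rfl
  have hstr : (ε ≪≫ φ).hom ≫ pullback.fst _ _ ≫ coprod.desc (structMap K R₁) (structMap K R₂) =
      structMap K B := by
    have := congrArg (· ≫ structMap K (R₁ × R₂)) key
    simp only [Category.assoc, coprodSpec_comp_structMap] at this
    rw [this, ← Spec.map_comp]
    congr 1
    ext x
    exact e.commutes x
  generalize ε ≪≫ φ = ψ at key hstr
  clear hφ hε
  clear ε φ
  refine ⟨(Over.isoMk ψ hstr).symm, ?_⟩
  exact key

end Scheme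

/-! ### Laurent polynomial rings as rings of functions -/

section Laurent

variable {K : Type*} [Field K] {Y V ι : Type*} [Fintype ι]

/-- The functions `t : V → Kˣ` such that `t` and `t⁻¹` lie in a given algebra of functions. -/
def unitFunctions (S : Subalgebra K (V → K)) : Subgroup (V → Kˣ) where
  carrier := {t | (fun v => (t v : K)) ∈ S ∧ (fun v => ((t v)⁻¹ : Kˣ).1) ∈ S}
  mul_mem' ha hb := ⟨by simpa [Pi.mul_def] using S.mul_mem ha.1 hb.1, by
    simpa [mul_comm, Pi.mul_def] using S.mul_mem ha.2 hb.2⟩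
  one_mem' := ⟨by simpa [Pi.one_def] using S.one_mem, by simpa [Pi.one_def] using S.one_mem⟩
  inv_mem' ha := ⟨ha.2, by simpa using ha.1⟩

/-- The character `w ↦ ∏ w_j ^ m_j` of the torus `(Kˣ)^ι`. -/
def torusChar (K : Type*) [Field K] (m : ι → ℤ) : (ι → Kˣ) →* K where
  toFun w := ((∏ j, w j ^ m j : Kˣ) : K)
  map_one' := by simp
  map_mul' w w' := by simp [mul_zpow, Finset.prod_mul_distrib]

theorem exists_zpow_ne_one [Infinite K] {n : ℤ} (hn : n ≠ 0) : ∃ x : Kˣ, x ^ n ≠ 1 := by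
  classical
  have hpos : 0 < n.natAbs := Int.natAbs_pos.2 hn
  obtain ⟨x, hx⟩ := Infinite.exists_notMem_finset
    (insert 0 (Polynomial.nthRootsFinset n.natAbs (1 : K)))
  rw [Finset.mem_insert, Polynomial.mem_nthRootsFinset hpos, not_or] at hx
  obtain ⟨hx0, hx1⟩ := hx
  refine ⟨Units.mk0 x hx0, fun h => hx1 ?_⟩
  have h1 : (Units.mk0 x hx0) ^ n.natAbs = 1 := by
    rw [← zpow_natCast]
    rcases abs_choice n with h' | h' <;> rw [Int.natCast_natAbs, h']
    · exact h
    · rw [zpow_neg, h, inv_one]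
  simpa using congrArg Units.val h1

/-- Restricting to the `j`-th coordinate subgroup recovers the `j`-th exponent, because over an
infinite field no nonzero power is identically `1`. -/
theorem torusChar_injective [Infinite K] :
    Function.Injective (torusChar K : (ι → ℤ) → (ι → Kˣ) →* K) := by
  classical
  intro m m' h
  by_contra hne
  obtain ⟨j, hj⟩ := Function.ne_iff.1 hne
  obtain ⟨x, hx⟩ := exists_zpow_ne_one (K := K) (sub_ne_zero.2 hj)
  apply hx
  have := DFunLike.congr_fun h (Pi.mulSingle j x)
  have e : ∀ n : ι → ℤ, torusChar K n (Pi.mulSingle j x) = ((x ^ n j : Kˣ) : K) := by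
    intro n
    change ((∏ i, (Pi.mulSingle j x : ι → Kˣ) i ^ n i : Kˣ) : K) = _
    rw [Finset.prod_eq_single j]
    · simp
    · intro i _ hi; simp [Pi.mulSingle_eq_of_ne hi]
    · simp
  rw [e, e, Units.val_inj] at this
  rw [zpow_sub, this, mul_inv_cancel]

/-- Laurent polynomials as functions on the torus. -/
noncomputable def torusEval (K : Type*) [Field K] (ι : Type*) [Fintype ι] :
    AddMonoidAlgebra K (ι → ℤ) →ₐ[K] ((ι → Kˣ) → K) :=
  AddMonoidAlgebra.lift K ((ι → Kˣ) → K) (ι → ℤ)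
    { toFun m := torusChar K (Multiplicative.toAdd m)
      map_one' := by ext v; simp [torusChar]
      map_mul' m m' := by
        ext v
        simp [torusChar, zpow_add, Finset.prod_mul_distrib] }

/-- Distinct exponents give distinct characters, and distinct characters are linearly independent
(Dedekind). -/
theorem torusEval_injective [Infinite K] : Function.Injective (torusEval K ι) := by
  rw [injective_iff_map_eq_zero]
  intro p hp
  have hli := (linearIndependent_monoidHom (ι → Kˣ) K).comp _ (torusChar_injective (ι := ι))
  rw [linearIndependent_iff] at hli
  have := hli p.coeff (by
    rw [← hp]
    rw [torusEval, AddMonoidAlgebra.lift_apply, Finsupp.linearCombination_apply]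
    rfl)
  ext m
  simp [this]

/-- Laurent polynomials with coefficients in an algebra of functions on `Y`, as functions on a set
`V` with maps `π : V → Y` and `u : V → (Kˣ)^ι`. -/
noncomputable def laurentEval (A : Subalgebra K (Y → K)) (π : V → Y)
    (u : V → ι → Kˣ) : AddMonoidAlgebra A (ι → ℤ) →ₐ[K] (V → K) :=
  AlgHom.pi fun v => (Pi.evalAlgHom K (fun _ => K) (u v)).comp <| (torusEval K ι).comp <|
    AddMonoidAlgebra.mapAlgHom (ι → ℤ) ((Pi.evalAlgHom K (fun _ => K) (π v)).comp A.val)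

theorem laurentEval_apply (A : Subalgebra K (Y → K)) (π : V → Y)
    (u : V → ι → Kˣ) (p : AddMonoidAlgebra A (ι → ℤ)) (v : V) :
    laurentEval A π u p v = torusEval K ι (AddMonoidAlgebra.mapAlgHom (ι → ℤ)
      ((Pi.evalAlgHom K (fun _ => K) (π v)).comp A.val) p) (u v) := rfl

theorem laurentEval_single (A : Subalgebra K (Y → K)) (π : V → Y)
    (u : V → ι → Kˣ) (m : ι → ℤ) (a : A) (v : V) :
    laurentEval A π u (.single m a) v = a.1 (π v) * ((∏ j, u v j ^ m j : Kˣ) : K) := by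
  simp [laurentEval, torusEval, torusChar]

theorem comp_mem_range_laurentEval {A : Subalgebra K (Y → K)} (π : V → Y)
    (u : V → ι → Kˣ) {a : Y → K} (ha : a ∈ A) :
    (fun v => a (π v)) ∈ (laurentEval A π u).range :=
  ⟨.single 0 ⟨a, ha⟩, by ext v; exact (laurentEval_single A π u 0 ⟨a, ha⟩ v).trans (by simp)⟩

theorem coord_mem_unitFunctions_range_laurentEval (A : Subalgebra K (Y → K)) (π : V → Y)
    (u : V → ι → Kˣ) (j : ι) :
    (fun v => u v j) ∈ unitFunctions (laurentEval A π u).range := by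
  classical
  have key : ∀ n : ℤ, (fun v => ((u v j ^ n : Kˣ) : K)) ∈ (laurentEval A π u).range := by
    intro n
    refine ⟨.single (Pi.single j n) 1, ?_⟩
    ext v
    refine (laurentEval_single A π u _ 1 v).trans ?_
    rw [Finset.prod_eq_single j]
    · simp
    · intro i _ hi; simp [Pi.single_eq_of_ne hi]
    · simp
  refine ⟨?_, ?_⟩
  · simpa using key 1
  · simpa using key (-1)

/-- Let `s : Y × (Kˣ)^ι → V` be a slice which meets every fibre of the functions in `B`. If these
functions restrict to Laurent polynomials over `O` on the slice, then `B` is the algebra of Laurent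
polynomials over the invariants `A` of `O`. -/
theorem exists_laurent_algEquiv [Infinite K] {O A : Subalgebra K (Y → K)}
    {B : Subalgebra K (V → K)} (r : Y → Y → Prop)
    (hA : ∀ a, a ∈ A ↔ a ∈ O ∧ ∀ y y', r y y' → a y' = a y)
    (π : V → Y) (u : V → ι → Kˣ) (s : Y → (ι → Kˣ) → V)
    (hπ : ∀ y w, π (s y w) = y) (hu : ∀ y w, u (s y w) = w)
    (hs : ∀ f ∈ B, ∀ v, f (s (π v) (u v)) = f v)
    (hr : ∀ f ∈ B, ∀ y y' w, r y y' → f (s y' w) = f (s y w))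
    (hAB : ∀ a ∈ A, (fun v => a (π v)) ∈ B)
    (huB : ∀ j, (fun v => u v j) ∈ unitFunctions B)
    (hB : ∀ f ∈ B, (fun p : Y × (ι → Kˣ) => f (s p.1 p.2)) ∈
      (laurentEval O Prod.fst Prod.snd).range) :
    ∃ e : AddMonoidAlgebra A (ι → ℤ) ≃ₐ[K] B,
      ∀ a v, (e (.single 0 a)).1 v = a.1 (π v) := by
  have hmem : ∀ p, laurentEval A π u p ∈ B := by
    intro p
    induction p using AddMonoidAlgebra.induction_linear with
    | zero => rw [map_zero]; exact B.zero_mem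
    | add p q hp hq => rw [map_add]; exact B.add_mem hp hq
    | single m a =>
      have h1 : (fun v => ∏ j, u v j ^ m j) ∈ unitFunctions B := by
        have := Subgroup.prod_mem (unitFunctions B) (t := Finset.univ)
          (f := fun j => (fun v => u v j) ^ m j) fun j _ => Subgroup.zpow_mem _ (huB j) _
        convert this using 1
        ext v
        simp
      have h2 : laurentEval A π u (.single m a) =
          (fun v => a.1 (π v)) * fun v => ((∏ j, u v j ^ m j : Kˣ) : K) := by
        ext v; exact laurentEval_single A π u m a v
      rw [h2]
      exact B.mul_mem (hAB _ a.2) h1.1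
  have hinj : Function.Injective (laurentEval A π u) := by
    rw [injective_iff_map_eq_zero]
    intro p hp
    refine AddMonoidAlgebra.ext (Finsupp.ext fun m => Subtype.ext (funext fun y => ?_))
    -- For fixed `y` the slice runs through the whole torus, so the Laurent polynomial with
    -- coefficients evaluated at `y` vanishes identically.
    have h0 : AddMonoidAlgebra.mapAlgHom (ι → ℤ)
        ((Pi.evalAlgHom K (fun _ => K) y).comp A.val) p = 0 := by
      apply torusEval_injective
      ext w
      have := congrFun hp (s y w)
      rw [laurentEval_apply, hπ, hu] at this
      simpa using this
    have := congrArg (fun q => q.coeff m) h0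
    simpa using this
  refine ⟨AlgEquiv.ofBijective ((laurentEval A π u).codRestrict B hmem) ⟨?_, ?_⟩, ?_⟩
  · intro p q h
    exact hinj (congrArg Subtype.val h)
  · rintro ⟨f, hf⟩
    obtain ⟨p, hp⟩ := hB f hf
    have hp' : ∀ y w, torusEval K ι (AddMonoidAlgebra.mapAlgHom (ι → ℤ)
        ((Pi.evalAlgHom K (fun _ => K) y).comp O.val) p) w = f (s y w) :=
      fun y w => congrFun hp (y, w)
    -- A Laurent polynomial is determined by its values, so invariance of the function on the slice
    -- passes to each coefficient.
    have hcoeff : ∀ m, (p.coeff m : Y → K) ∈ A := by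
      intro m
      refine (hA _).2 ⟨(p.coeff m).2, fun y y' hyy => ?_⟩
      have : AddMonoidAlgebra.mapAlgHom (ι → ℤ)
          ((Pi.evalAlgHom K (fun _ => K) y').comp O.val) p = AddMonoidAlgebra.mapAlgHom (ι → ℤ)
          ((Pi.evalAlgHom K (fun _ => K) y).comp O.val) p := by
        apply torusEval_injective
        ext w
        rw [hp', hp', hr f hf y y' w hyy]
      simpa using congrArg (fun q => q.coeff m) this
    let q : AddMonoidAlgebra A (ι → ℤ) := .ofCoeff <|
      Finsupp.onFinset p.coeff.support (fun m => ⟨p.coeff m, hcoeff m⟩) fun m hm => by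
        rw [Finsupp.mem_support_iff]
        rintro h
        apply hm
        exact Subtype.ext (congrArg (Subtype.val : O → Y → K) h)
    refine ⟨q, Subtype.ext ?_⟩
    ext v
    change laurentEval A π u q v = f v
    rw [laurentEval_apply, ← hs f hf v, ← hp']
    refine congrArg (fun z => torusEval K ι z (u v)) ?_
    refine AddMonoidAlgebra.ext (Finsupp.ext fun m => ?_)
    simp [q]
  · intro a v
    exact (laurentEval_single A π u 0 a v).trans (by simp)

end Laurent

/-! ### Scalars, the involution `σ` and alternating products -/

section Sigma

variable {K : Type*} [Field K] {n : ℕ}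

theorem coe_scale (t : Kˣ) (h : GL (Fin n) K) :
    (scale t h : Matrix (Fin n) (Fin n) K) = (t : K) • (h : Matrix (Fin n) (Fin n) K) := by
  rw [scale, Units.val_mul, Units.coe_map, Algebra.smul_def]
  rfl

theorem scale_mul_scale (s t : Kˣ) (a b : GL (Fin n) K) :
    scale s a * scale t b = scale (s * t) (a * b) := by
  apply Units.ext
  simp only [Units.val_mul, coe_scale, Matrix.smul_mul, Matrix.mul_smul, smul_smul, mul_comm]

theorem scale_one (a : GL (Fin n) K) : scale 1 a = a := by
  apply Units.ext
  rw [coe_scale, Units.val_one, one_smul]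

theorem scale_scale (s t : Kˣ) (a : GL (Fin n) K) : scale s (scale t a) = scale (s * t) a := by
  apply Units.ext
  simp only [coe_scale, Units.val_mul, smul_smul]

theorem mul_scale (t : Kˣ) (a b : GL (Fin n) K) : a * scale t b = scale t (a * b) := by
  nth_rw 1 [← scale_one a]
  rw [scale_mul_scale, one_mul]

theorem scale_mul (t : Kˣ) (a b : GL (Fin n) K) : scale t a * b = scale t (a * b) := by
  nth_rw 1 [← scale_one b]
  rw [scale_mul_scale, mul_one]

theorem scale_inv (t : Kˣ) (a : GL (Fin n) K) : (scale t a)⁻¹ = scale t⁻¹ a⁻¹ := by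
  rw [inv_eq_iff_mul_eq_one, scale_mul_scale, mul_inv_cancel, mul_inv_cancel, scale_one]

theorem invTranspose_scale (t : Kˣ) (a : GL (Fin n) K) :
    invTranspose (scale t a) = scale t⁻¹ (invTranspose a) := by
  apply Units.ext
  rw [coe_scale]
  change (((scale t a)⁻¹ : GL (Fin n) K) : Matrix (Fin n) (Fin n) K).transpose =
    ((t⁻¹ : Kˣ) : K) • ((a⁻¹ : GL (Fin n) K) : Matrix (Fin n) (Fin n) K).transpose
  rw [scale_inv, coe_scale, Matrix.transpose_smul]

theorem sigmaAut_scale (t : Kˣ) (a : GL (Fin n) K) :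
    sigmaAut K n (scale t a) = scale t⁻¹ (sigmaAut K n a) := by
  change jGL K n * invTranspose (scale t a) * (jGL K n)⁻¹ =
    scale t⁻¹ (jGL K n * invTranspose a * (jGL K n)⁻¹)
  rw [invTranspose_scale, mul_scale, scale_mul]

theorem sigmaAut_two (a : GL (Fin 2) K) :
    sigmaAut K 2 a = scale (Matrix.GeneralLinearGroup.det a)⁻¹ a := by
  have hJ : jMatrix K 2 = !![0, 1; -1, 0] := by
    ext i j
    fin_cases i <;> fin_cases j <;> simp [jMatrix, jSign, Fin.rev]
  have key : jGL K 2 * invTranspose a =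
      scale (Matrix.GeneralLinearGroup.det a)⁻¹ a * jGL K 2 := by
    have hinv : ((a⁻¹ : GL (Fin 2) K) : Matrix (Fin 2) (Fin 2) K) =
        (a.1.det)⁻¹ • !![a.1 1 1, -a.1 0 1; -a.1 1 0, a.1 0 0] := by
      rw [Matrix.coe_units_inv, Matrix.inv_def, Matrix.adjugate_fin_two, Ring.inverse_eq_inv']
    apply Units.ext
    rw [Units.val_mul, Units.val_mul, coe_scale]
    change jMatrix K 2 * ((a⁻¹ : GL (Fin 2) K) : Matrix (Fin 2) (Fin 2) K).transpose =
      _ * jMatrix K 2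
    rw [hinv, hJ]
    ext i j
    fin_cases i <;> fin_cases j <;> simp [Matrix.mul_apply, Fin.sum_univ_two]
  change jGL K 2 * invTranspose a * (jGL K 2)⁻¹ = _
  rw [key, mul_inv_cancel_right]

theorem sigmaElt_mul_incl (a : GL (Fin n) K) :
    sigmaElt K n * incl K n a = incl K n (sigmaAut K n a) * sigmaElt K n := by
  ext1
  · change (1 : GL (Fin n) K) * sigmaAction K n (Multiplicative.ofAdd 1) a =
      sigmaAut K n a * sigmaAction K n 1 1
    rw [one_mul, map_one (sigmaAction K n 1), mul_one]
    rfl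
  · simp [sigmaElt, incl]

theorem sigmaElt_mul_self : sigmaElt K n * sigmaElt K n = 1 := by
  rw [sigmaElt, ← map_mul, ← ofAdd_add, show (1 : ZMod 2) + 1 = 0 by decide, ofAdd_zero, map_one]

theorem left_incl_mul_sigmaElt (a : GL (Fin n) K) : (incl K n a * sigmaElt K n).left = a := by
  simp [sigmaElt, incl]

theorem incl_mul_sigmaElt_injective {a b : GL (Fin n) K}
    (h : incl K n a * sigmaElt K n = incl K n b * sigmaElt K n) : a = b := by
  rw [← left_incl_mul_sigmaElt a, h, left_incl_mul_sigmaElt]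

theorem incl_conj (h a : GL (Fin n) K) :
    incl K n h * (incl K n a * sigmaElt K n) * (incl K n h)⁻¹ =
      incl K n (h * a * sigmaAut K n h⁻¹) * sigmaElt K n := by
  rw [← map_inv, mul_assoc, mul_assoc (incl K n a), sigmaElt_mul_incl, map_mul, map_mul]
  simp only [mul_assoc]

theorem incl_conj_two (h a : GL (Fin 2) K) :
    incl K 2 h * (incl K 2 a * sigmaElt K 2) * (incl K 2 h)⁻¹ =
      incl K 2 (scale (Matrix.GeneralLinearGroup.det h) (h * a * h⁻¹)) * sigmaElt K 2 := by
  rw [incl_conj, sigmaAut_two, mul_scale, map_inv, inv_inv]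

/-- The alternating product `t₀ t₁⁻¹ t₂ t₃⁻¹ ⋯`. -/
def altProd {m : ℕ} (t : Fin m → Kˣ) : Kˣ := ∏ j, t j ^ ((-1 : ℤ) ^ (j : ℕ))

theorem altProd_succ {m : ℕ} (t : Fin (m + 1) → Kˣ) :
    altProd t = t 0 * (altProd (Fin.tail t))⁻¹ := by
  simp [altProd, Fin.prod_univ_succ, pow_succ, Fin.tail]

theorem altProd_const_mul {m : ℕ} (hm : Even m) (c : Kˣ) (t : Fin m → Kˣ) :
    altProd (fun j => c * t j) = altProd t := by
  have : ∀ m : ℕ, altProd (fun _ : Fin (m + m) => c) = 1 := by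
    intro m
    induction m with
    | zero => simp [altProd]
    | succ m ih =>
      have : m + 1 + (m + 1) = m + m + 1 + 1 := by ring
      rw [this, altProd_succ, altProd_succ]
      change c * (c * (altProd (fun _ : Fin (m + m) => c))⁻¹)⁻¹ = 1
      simp [ih]
  obtain ⟨r, rfl⟩ := hm
  rw [← one_mul (altProd t), ← this r]
  simp only [altProd, mul_zpow, Finset.prod_mul_distrib]

theorem altProd_cons_snoc {d : ℕ} (hd : Even d) (a w : Kˣ) (u : Fin d → Kˣ) :
    altProd (Fin.cons a (Fin.snoc u w : Fin (d + 1) → Kˣ) : Fin (d + 2) → Kˣ) =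
      a * (altProd u * w)⁻¹ := by
  rw [altProd_succ, Fin.tail_cons, Fin.cons_zero]
  simp [altProd, Fin.prod_univ_castSucc, hd]

/-- Moving a `σ` to the right past the later factors inverts their scalars and leaves the `σ`-fixed
parts alone, whence the alternating signs. -/
theorem prod_incl_scale_mul_sigmaElt {m : ℕ} (t : Fin m → Kˣ) (s : Fin m → GL (Fin n) K)
    (hs : ∀ j, sigmaAut K n (s j) = s j) :
    (List.ofFn fun j => incl K n (scale (t j) (s j)) * sigmaElt K n).prod =
      incl K n (scale (altProd t) (List.ofFn s).prod) * sigmaElt K n ^ m := by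
  induction m with
  | zero => simp [altProd, scale_one]
  | succ m ih =>
    have hfix : sigmaAut K n (List.ofFn (Fin.tail s)).prod = (List.ofFn (Fin.tail s)).prod := by
      rw [map_list_prod, List.map_ofFn]
      congr 2
      ext1 j
      exact hs _
    have := ih (Fin.tail t) (Fin.tail s) fun j => hs _
    rw [List.ofFn_succ, List.prod_cons]
    simp only [Fin.tail] at this
    rw [this, altProd_succ, List.ofFn_succ, List.prod_cons, ← scale_mul_scale, map_mul]
    change _ * (incl K n (scale (altProd (Fin.tail t)) (List.ofFn (Fin.tail s)).prod) * _) = _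
    rw [mul_assoc, ← mul_assoc (sigmaElt K n), sigmaElt_mul_incl, sigmaAut_scale, hfix, pow_succ',
      mul_assoc, mul_assoc]
    rfl

end Sigma

/-! ### Outer classes of `GL_2` and classes of `SL_2` -/

section Lift

open Matrix (SpecialLinearGroup)

variable {K : Type*} [Field K]

theorem exists_units_sq [IsAlgClosed K] (t : Kˣ) : ∃ z : Kˣ, z * z = t := by
  obtain ⟨z, hz⟩ := IsAlgClosed.exists_eq_mul_self (t : K)
  refine ⟨Units.mk0 z ?_, ?_⟩
  · rintro rfl
    simp at hz
  · ext
    simp [hz]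

theorem det_scale_two (t : Kˣ) (a : GL (Fin 2) K) :
    Matrix.GeneralLinearGroup.det (scale t a) = t * t * Matrix.GeneralLinearGroup.det a := by
  ext
  rw [Matrix.GeneralLinearGroup.val_det_apply, coe_scale, Matrix.det_smul]
  simp [pow_two]

theorem exists_eq_scale [IsAlgClosed K] (h : GL (Fin 2) K) :
    ∃ (z : Kˣ) (s : SpecialLinearGroup (Fin 2) K),
      z * z = Matrix.GeneralLinearGroup.det h ∧ h = scale z (s : GL (Fin 2) K) := by
  obtain ⟨z, hz⟩ := exists_units_sq (Matrix.GeneralLinearGroup.det h)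
  have hdet : (scale z⁻¹ h).1.det = 1 := by
    have := congrArg Units.val (det_scale_two z⁻¹ h)
    rw [← hz] at this
    rw [Matrix.GeneralLinearGroup.val_det_apply] at this
    rw [this]
    simp
  refine ⟨z, ⟨_, hdet⟩, hz, ?_⟩
  have : SpecialLinearGroup.toGL (⟨_, hdet⟩ : SpecialLinearGroup (Fin 2) K) = scale z⁻¹ h :=
    Units.ext rfl
  rw [this, scale_scale, mul_inv_cancel, scale_one]

theorem scale_neg_coe (t : Kˣ) (s : SpecialLinearGroup (Fin 2) K) :
    scale (-t) ((-s : SpecialLinearGroup (Fin 2) K) : GL (Fin 2) K) =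
      scale t (s : GL (Fin 2) K) := by
  apply Units.ext
  rw [coe_scale, coe_scale]
  simp

theorem scale_coe_eq_iff {t t' : Kˣ} {s s' : SpecialLinearGroup (Fin 2) K}
    (h : scale t (s : GL (Fin 2) K) = scale t' (s' : GL (Fin 2) K)) :
    s = s' ∨ s = -s' := by
  have hdet := congrArg Matrix.GeneralLinearGroup.det h
  have h1 : ∀ s : SpecialLinearGroup (Fin 2) K,
    Matrix.GeneralLinearGroup.det (s : GL (Fin 2) K) = 1 := fun s => by ext; simp
  rw [det_scale_two, det_scale_two, h1, h1, mul_one, mul_one] at hdet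
  have hm : (t : K) • (s : Matrix (Fin 2) (Fin 2) K) = (t' : K) • (s' : Matrix (Fin 2) (Fin 2) K) := by
    have := congrArg Units.val h
    rwa [coe_scale, coe_scale] at this
  have hd : (t : K) * t = t' * t' := congrArg Units.val hdet
  rcases mul_self_eq_mul_self_iff.1 hd with e | e
  · left
    ext i j
    have := congrFun (congrFun hm i) j
    rw [e] at this
    exact mul_left_cancel₀ t'.ne_zero this
  · right
    ext i j
    have := congrFun (congrFun hm i) j
    rw [e] at this
    apply mul_left_cancel₀ (neg_ne_zero.2 t'.ne_zero)
    simpa using this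

theorem coe_conj_eq_conj_scale (z : Kˣ) (u s : SpecialLinearGroup (Fin 2) K) :
    scale z (u : GL (Fin 2) K) * (s : GL (Fin 2) K) * (scale z (u : GL (Fin 2) K))⁻¹ =
      ((u * s * u⁻¹ : SpecialLinearGroup (Fin 2) K) : GL (Fin 2) K) := by
  rw [scale_inv, scale_mul, scale_mul_scale, mul_inv_cancel, scale_one]
  simp

/-- Write a representative as `t₀ s₀ σ` with `s₀ ∈ SL_2`. Conjugation by `z u`, with `u ∈ SL_2`,
gives `z² t₀ (u s₀ u⁻¹) σ`. Since squares exhaust `K^×`, the scalar becomes arbitrary and only the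
class of `s₀` up to sign remains. -/
theorem exists_isLift [IsAlgClosed K] {C : Set (GLSigma K 2)} (hC : IsSemisimpleOuterClass C) :
    ∃ C', IsLift C C' := by
  obtain ⟨_, ⟨h₀, rfl⟩, -, rfl⟩ := hC
  obtain ⟨t₀, s₀, -, rfl⟩ := exists_eq_scale h₀
  refine ⟨{s' | ∃ u, s' = u * s₀ * u⁻¹}, ⟨s₀, rfl⟩, ?_⟩
  have hconj : ∀ (z : Kˣ) (u : SpecialLinearGroup (Fin 2) K),
      incl K 2 (scale z u) * (incl K 2 (scale t₀ s₀) * sigmaElt K 2) * (incl K 2 (scale z u))⁻¹ =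
        incl K 2 (scale (z * z * t₀) ((u * s₀ * u⁻¹ : SpecialLinearGroup (Fin 2) K) :
          GL (Fin 2) K)) * sigmaElt K 2 := by
    intro z u
    have h1 : Matrix.GeneralLinearGroup.det (u : GL (Fin 2) K) = 1 := by ext; simp
    rw [incl_conj_two, mul_scale, scale_mul, coe_conj_eq_conj_scale, scale_scale, det_scale_two,
      h1, mul_one]
  have hex : ∀ (t : Kˣ) (u : SpecialLinearGroup (Fin 2) K), ∃ h : GL (Fin 2) K,
      incl K 2 (scale t ((u * s₀ * u⁻¹ : SpecialLinearGroup (Fin 2) K) : GL (Fin 2) K)) *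
        sigmaElt K 2 =
      incl K 2 h * (incl K 2 (scale t₀ s₀) * sigmaElt K 2) * (incl K 2 h)⁻¹ := by
    intro t u
    obtain ⟨z, hz⟩ := exists_units_sq (t * t₀⁻¹)
    exact ⟨scale z u, by rw [hconj, hz, inv_mul_cancel_right]⟩
  ext ⟨t, s⟩
  constructor
  · rintro ⟨h, hh⟩
    obtain ⟨z, u, -, rfl⟩ := exists_eq_scale h
    rw [hconj] at hh
    rcases scale_coe_eq_iff (incl_mul_sigmaElt_injective hh) with e | e
    · exact Or.inl ⟨u, e⟩
    · exact Or.inr ⟨u, by rw [e, neg_neg]⟩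
  · rintro (⟨u, hu⟩ | ⟨u, hu⟩)
    · obtain ⟨h, hh⟩ := hex t u
      exact ⟨h, by rw [← hh]; dsimp only at hu ⊢; rw [hu]⟩
    · obtain ⟨h, hh⟩ := hex (-t) u
      refine ⟨h, ?_⟩
      rw [← hh]
      dsimp only at hu ⊢
      rw [← hu, scale_neg_coe]

theorem subset_outerComponent {n : ℕ} {C : Set (GLSigma K n)} (hC : IsSemisimpleOuterClass C) :
    C ⊆ outerComponent K n := by
  obtain ⟨_, ⟨h₀, rfl⟩, -, rfl⟩ := hC
  rintro _ ⟨h, rfl⟩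
  exact ⟨_, incl_conj h h₀⟩

/-- A trace zero element of `SL₂` is conjugate to `diag(i, -i)`. -/
theorem exists_conj_diagSL [IsAlgClosed K] (hchar : (2 : K) ≠ 0)
    (s : SpecialLinearGroup (Fin 2) K) (hs : s.1.trace = 0) :
    ∃ (a : Kˣ) (u : SpecialLinearGroup (Fin 2) K), (a : K) ^ 2 = -1 ∧
      diagSL a = u * s * u⁻¹ := by
  obtain ⟨i, hi⟩ := IsAlgClosed.exists_eq_mul_self (-1 : K)
  have hi0 : i ≠ 0 := by rintro rfl; simp at hi
  have hinv : i⁻¹ = -i := by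
    rw [inv_eq_iff_eq_inv, eq_comm, inv_eq_of_mul_eq_one_left]
    rw [mul_neg, ← hi, neg_neg]
  have h11 : s.1 1 1 = - s.1 0 0 := by
    rw [Matrix.trace_fin_two] at hs
    exact eq_neg_of_add_eq_zero_right hs
  have hdet : s.1 0 0 * s.1 1 1 - s.1 0 1 * s.1 1 0 = 1 := by
    rw [← Matrix.det_fin_two]; exact s.2
  rw [h11] at hdet
  -- It suffices to give independent eigenvectors `(a, c)` for `i` and `(b, d)` for `-i`. Dividing
  -- the second one by the determinant puts the change of basis in `SL_2`.
  have hmk : ∀ (a b c d : K), a * d - b * c ≠ 0 →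
      (!![a, b; c, d] : Matrix (Fin 2) (Fin 2) K) * !![i, 0; 0, -i] = s.1 * !![a, b; c, d] →
      ∃ u : SpecialLinearGroup (Fin 2) K, diagSL (Units.mk0 i hi0) = u * s * u⁻¹ := by
    intro a b c d hne h
    obtain ⟨P, hP⟩ : ∃ P : SpecialLinearGroup (Fin 2) K,
        P.1 = !![a, b / (a * d - b * c); c, d / (a * d - b * c)] := by
      refine ⟨⟨_, ?_⟩, rfl⟩
      rw [Matrix.det_fin_two_of, mul_div_assoc', div_mul_eq_mul_div, ← sub_div, div_self hne]
    refine ⟨P⁻¹, ?_⟩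
    rw [inv_inv, mul_assoc, eq_inv_mul_iff_mul_eq]
    apply Subtype.ext
    have e1 : (P * diagSL (Units.mk0 i hi0)).1 = P.1 * !![i, 0; 0, -i] := by
      rw [← hinv]; rfl
    have e2 : (s * P).1 = s.1 * P.1 := rfl
    rw [e1, e2, hP]
    have h' : ∀ j k, ((!![a, b; c, d] : Matrix (Fin 2) (Fin 2) K) * !![i, 0; 0, -i]) j k =
      (s.1 * !![a, b; c, d]) j k := fun j k => by rw [h]
    simp only [Matrix.mul_apply, Fin.sum_univ_two] at h'
    have h00 := h' 0 0
    have h01 := h' 0 1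
    have h10 := h' 1 0
    have h11 := h' 1 1
    ext j k
    fin_cases j <;> fin_cases k <;> simp [Matrix.mul_apply, Fin.sum_univ_two] at *
    · linear_combination h00
    · linear_combination (a * d - b * c)⁻¹ * h01
    · linear_combination h10
    · linear_combination (a * d - b * c)⁻¹ * h11
  have hia : (Units.mk0 i hi0 : K) ^ 2 = -1 := by rw [hi, pow_two]; rfl
  -- The characteristic polynomial is `x² + 1`, whose roots `±i` are distinct because `2 ≠ 0`. If
  -- both off-diagonal entries vanish, `s` is already `diag(±i, ∓i)`; otherwise a nonzero
  -- off-diagonal entry yields explicit eigenvectors.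
  have hsq : (s.1 0 0 - i) * (s.1 0 0 + i) = - (s.1 0 1 * s.1 1 0) := by
    linear_combination - hdet + hi
  have h2i : 2 * i ≠ 0 := mul_ne_zero hchar hi0
  by_cases hb : s.1 0 1 = 0
  · by_cases hc : s.1 1 0 = 0
    · rw [hb, zero_mul, neg_zero, mul_eq_zero, sub_eq_zero, ← eq_neg_iff_add_eq_zero] at hsq
      have hs' : ∀ a : Kˣ, (a : K) = s.1 0 0 → (a : K) * a = -1 → diagSL a = 1 * s * 1⁻¹ := by
        intro a ha ha2
        rw [one_mul, inv_one, mul_one]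
        apply Subtype.ext
        have hai : ((a⁻¹ : Kˣ) : K) = - a := by
          rw [← mul_right_inj' a.ne_zero, Units.mul_inv, mul_neg, ha2, neg_neg]
        ext j k
        fin_cases j <;> fin_cases k
        · exact ha
        · exact hb.symm
        · exact hc.symm
        · change ((a⁻¹ : Kˣ) : K) = s.1 1 1
          rw [h11, hai, ha]
      rcases hsq with e | e
      · exact ⟨_, 1, hia, hs' _ e.symm hi.symm⟩
      · refine ⟨-Units.mk0 i hi0, 1, by rw [Units.val_neg, neg_sq, hia], hs' _ e.symm ?_⟩
        rw [Units.val_neg, neg_mul_neg, ← pow_two, hia]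
    · obtain ⟨u, hu⟩ := hmk (i + s.1 0 0) (-i + s.1 0 0) (s.1 1 0) (s.1 1 0)
        (by rw [← sub_mul]; refine mul_ne_zero ?_ hc; convert h2i using 1; ring) (by
          ext j k
          fin_cases j <;> fin_cases k <;>
            simp [Matrix.mul_apply, Fin.sum_univ_two, h11, hb] at hdet ⊢
          · linear_combination hdet - hi
          · linear_combination hdet - hi
          · ring
          · ring)
      exact ⟨_, u, hia, hu⟩
  · obtain ⟨u, hu⟩ := hmk (s.1 0 1) (s.1 0 1) (i - s.1 0 0) (-i - s.1 0 0)
      (by rw [← mul_sub]; refine mul_ne_zero hb ?_; convert neg_ne_zero.2 h2i using 1; ring) (by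
        ext j k
        fin_cases j <;> fin_cases k <;>
          simp [Matrix.mul_apply, Fin.sum_univ_two, h11] at hdet ⊢
        · ring
        · ring
        · linear_combination hdet - hi
        · linear_combination hdet - hi)
    exact ⟨_, u, hia, hu⟩

theorem CharVar.IsLift.scale_mem {C : Set (GLSigma K 2)} {C' : Set (SpecialLinearGroup (Fin 2) K)}
    (h : IsLift C C') {s : SpecialLinearGroup (Fin 2) K} (hs : s ∈ C') (t : Kˣ) :
    incl K 2 (scale t (s : GL (Fin 2) K)) * sigmaElt K 2 ∈ C := by
  have : (t, s) ∈ {p : Kˣ × SpecialLinearGroup (Fin 2) K | p.2 ∈ C'} ∪ {p | -p.2 ∈ C'} :=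
    Or.inl hs
  rw [← h.2] at this
  exact this

/-- With trace zero, `C'` would contain some `diag(a, a⁻¹)` with `a² = -1`, and taking the scalar
`1` would put the excluded element in `C`. -/
theorem CharVar.IsLift.trace_ne_zero [IsAlgClosed K] (hchar : (2 : K) ≠ 0) {C : Set (GLSigma K 2)}
    {C' : Set (SpecialLinearGroup (Fin 2) K)} (h : IsLift C C')
    (hC : ∀ a : Kˣ, incl K 2 (SpecialLinearGroup.toGL (diagSL a)) * sigmaElt K 2 ∈ C →
      (a : K) ^ 2 ≠ -1)
    {s : SpecialLinearGroup (Fin 2) K} (hs : s ∈ C') : s.1.trace ≠ 0 := by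
  intro h0
  obtain ⟨a, u, ha, hu⟩ := exists_conj_diagSL hchar s h0
  refine hC a ?_ ha
  have hmem : diagSL a ∈ C' := by
    obtain ⟨⟨s₀, rfl⟩, -⟩ := h
    obtain ⟨v, rfl⟩ := hs
    exact ⟨u * v, by rw [hu]; group⟩
  have := h.scale_mem hmem 1
  rwa [scale_one] at this

theorem CharVar.IsLift.trace_eq {C : Set (GLSigma K 2)}
    {C' : Set (SpecialLinearGroup (Fin 2) K)} (h : IsLift C C')
    {s s' : SpecialLinearGroup (Fin 2) K} (hs : s ∈ C') (hs' : s' ∈ C') :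
    s.1.trace = s'.1.trace := by
  obtain ⟨⟨s₀, rfl⟩, -⟩ := h
  have key : ∀ u : SpecialLinearGroup (Fin 2) K, (u * s₀ * u⁻¹).1.trace = s₀.1.trace := by
    intro u
    have e1 : (u * s₀ * u⁻¹).1 = (u * s₀).1 * (u⁻¹).1 := rfl
    have e2 : (u⁻¹).1 * (u * s₀).1 = (u⁻¹ * (u * s₀)).1 := rfl
    rw [e1, Matrix.trace_mul_comm, e2, inv_mul_cancel_left]
  obtain ⟨u, rfl⟩ := hs
  obtain ⟨v, rfl⟩ := hs'
  rw [key, key]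

/-- If `s` and `-s` were both in `C'`, their equal traces would give `2 tr s = 0`. -/
theorem CharVar.IsLift.disjoint [IsAlgClosed K] (hchar : (2 : K) ≠ 0) {C : Set (GLSigma K 2)}
    {C' : Set (SpecialLinearGroup (Fin 2) K)} (h : IsLift C C')
    (hC : ∀ a : Kˣ, incl K 2 (SpecialLinearGroup.toGL (diagSL a)) * sigmaElt K 2 ∈ C →
      (a : K) ^ 2 ≠ -1) : Disjoint {s | s ∈ C'} {s | -s ∈ C'} := by
  rw [Set.disjoint_left]
  intro s hs hs'
  apply h.trace_ne_zero hchar hC hs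
  have := h.trace_eq hs hs'
  rw [SpecialLinearGroup.coe_neg, Matrix.trace_neg, eq_neg_iff_add_eq_zero, ← two_mul] at this
  exact (mul_eq_zero.1 this).resolve_left hchar

theorem CharVar.IsLift.exists_eq [IsAlgClosed K] {C : Set (GLSigma K 2)}
    {C' : Set (SpecialLinearGroup (Fin 2) K)} (h : IsLift C C') (hC : C ⊆ outerComponent K 2)
    {x : GLSigma K 2} (hx : x ∈ C) :
    ∃ (t : Kˣ) (s : SpecialLinearGroup (Fin 2) K), s ∈ C' ∧
      x = incl K 2 (scale t (s : GL (Fin 2) K)) * sigmaElt K 2 := by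
  obtain ⟨a, rfl⟩ := hC hx
  obtain ⟨t, s, -, rfl⟩ := exists_eq_scale a
  have : (t, s) ∈ {p : Kˣ × SpecialLinearGroup (Fin 2) K |
      incl K 2 (scale p.1 (p.2 : GL (Fin 2) K)) * sigmaElt K 2 ∈ C} := hx
  rw [h.2] at this
  rcases this with hs | hs
  · exact ⟨t, s, hs, rfl⟩
  · exact ⟨-t, -s, hs, by rw [scale_neg_coe]⟩

end Lift

/-! ### Matrix-valued regular functions -/

section Regular

variable {K : Type*} [Field K] {n : ℕ}

/-- The matrix valued functions which, together with their inverses, have entries in a given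
algebra of functions. -/
def matrixFunctions {V : Type*} (S : Subalgebra K (V → K)) (n : ℕ) :
    Subgroup (V → GL (Fin n) K) where
  carrier := {M | ∀ a b, (fun v => (M v).1 a b) ∈ S ∧ (fun v => ((M v)⁻¹).1 a b) ∈ S}
  mul_mem' {M N} hM hN a b := by
    constructor
    · have : (fun v => ((M * N) v).1 a b) =
          ∑ c, (fun v => (M v).1 a c) * fun v => (N v).1 c b := by
        ext v
        simp [Matrix.mul_apply]
      rw [this]
      exact S.sum_mem fun c _ => S.mul_mem (hM a c).1 (hN c b).1
    · have : (fun v => ((M * N) v)⁻¹.1 a b) =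
          ∑ c, (fun v => (N v)⁻¹.1 a c) * fun v => (M v)⁻¹.1 c b := by
        ext v
        rw [Pi.mul_apply, mul_inv_rev, Units.val_mul, Matrix.mul_apply, Finset.sum_apply]
        rfl
      rw [this]
      exact S.sum_mem fun c _ => S.mul_mem (hN a c).2 (hM c b).2
  one_mem' a b := by
    have : (fun _ : V => (1 : Matrix (Fin n) (Fin n) K) a b) ∈ S := S.algebraMap_mem _
    simpa using this
  inv_mem' {M} hM a b := ⟨(hM a b).2, by simpa using (hM a b).1⟩

variable {V : Type*} {S : Subalgebra K (V → K)}

theorem trace_mem_of_mem_matrixFunctions {M : V → GL (Fin n) K} (hM : M ∈ matrixFunctions S n) :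
    (fun v => (M v).1.trace) ∈ S := by
  have : (fun v => (M v).1.trace) = ∑ a, fun v => (M v).1 a a := by
    ext v
    simp [Matrix.trace]
  rw [this]
  exact S.sum_mem fun a _ => (hM a a).1

theorem det_mem_unitFunctions {M : V → GL (Fin n) K} (hM : M ∈ matrixFunctions S n) :
    (fun v => Matrix.GeneralLinearGroup.det (M v)) ∈ unitFunctions S := by
  have key : ∀ N : V → Matrix (Fin n) (Fin n) K, (∀ a b, (fun v => N v a b) ∈ S) →
      (fun v => (N v).det) ∈ S := by
    intro N hN
    -- The determinant is formed over the ring `S` itself, so that membership is automatic;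
    -- evaluation at `v` commutes with it.
    have : (fun v => (N v).det) = (Matrix.of fun a b => (⟨_, hN a b⟩ : S)).det.1 := by
      ext v
      have := RingHom.map_det ((Pi.evalRingHom (fun _ : V => K) v).comp S.val.toRingHom)
        (Matrix.of fun a b => (⟨_, hN a b⟩ : S))
      exact this.symm
    rw [this]
    exact Subtype.prop _
  refine ⟨key _ fun a b => (hM a b).1, ?_⟩
  convert key _ fun a b => (hM a b).2 using 1
  ext v
  rw [← map_inv]
  rfl

theorem scale_mem_matrixFunctions {t : V → Kˣ} (ht : t ∈ unitFunctions S) {M : V → GL (Fin n) K}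
    (hM : M ∈ matrixFunctions S n) : (fun v => scale (t v) (M v)) ∈ matrixFunctions S n := by
  intro a b
  constructor
  · simp only [coe_scale]
    exact S.mul_mem ht.1 (hM a b).1
  · simp only [scale_inv, coe_scale]
    exact S.mul_mem ht.2 (hM a b).2

theorem comp_mem_matrixFunctions {W : Type*} {S' : Subalgebra K (W → K)} (φ : W → V)
    (h : ∀ f ∈ S, (fun w => f (φ w)) ∈ S') {M : V → GL (Fin n) K} (hM : M ∈ matrixFunctions S n) :
    (fun w => M (φ w)) ∈ matrixFunctions S' n :=
  fun a b => ⟨h _ (hM a b).1, h _ (hM a b).2⟩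

theorem comp_mem_unitFunctions {W : Type*} {S' : Subalgebra K (W → K)} (φ : W → V)
    (h : ∀ f ∈ S, (fun w => f (φ w)) ∈ S') {t : V → Kˣ} (ht : t ∈ unitFunctions S) :
    (fun w => t (φ w)) ∈ unitFunctions S' :=
  ⟨h _ ht.1, h _ ht.2⟩

end Regular

/-! ### Regular and invariant functions on sets of tuples -/

section Tuples

universe u

variable {K : Type u} [Field K] {n g m : ℕ} {H : Type u}

theorem tupleMatrix_mem_matrixFunctions (c : H → GL (Fin n) K) (W : Set (Tuples K n g m H))
    (r : Fin g ⊕ Fin g ⊕ Fin m) :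
    (fun x : W => tupleMatrix c x.1 r) ∈ matrixFunctions (regularFunctions c W) n :=
  fun a b => ⟨Algebra.subset_adjoin ⟨r, a, b, Or.inl rfl⟩,
    Algebra.subset_adjoin ⟨r, a, b, Or.inr rfl⟩⟩

/-- Regular functions pull back to regular functions under maps with regular coordinates. -/
theorem comp_mem_of_tupleMatrix_mem {V : Type*} {S : Subalgebra K (V → K)} {c : H → GL (Fin n) K}
    {W : Set (Tuples K n g m H)} (φ : V → W)
    (h : ∀ r, (fun v => tupleMatrix c (φ v).1 r) ∈ matrixFunctions S n) :
    ∀ f ∈ regularFunctions c W, (fun v => f (φ v)) ∈ S := by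
  let F : (W → K) →ₐ[K] (V → K) := AlgHom.pi fun v => Pi.evalAlgHom K (fun _ => K) (φ v)
  have : regularFunctions c W ≤ S.comap F := by
    refine Algebra.adjoin_le ?_
    rintro _ ⟨r, a, b, rfl | rfl⟩
    · exact (h r a b).1
    · exact (h r a b).2
  exact fun f hf => this hf

variable [Group H]

/-- The product `∏ [A_i, B_i] ∏ X_j`. -/
def totalProd (ι : GL (Fin n) K →* H) (x : Tuples K n g m H) : H :=
  ι (List.ofFn fun i => (x.1 i).1 * (x.1 i).2 * (x.1 i).1⁻¹ * (x.1 i).2⁻¹).prod *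
    (List.ofFn x.2).prod

theorem totalProd_conjTuple (ι : GL (Fin n) K →* H) (h : GL (Fin n) K) (x : Tuples K n g m H) :
    totalProd ι (conjTuple ι h x) = ι h * totalProd ι x * (ι h)⁻¹ := by
  have h1 : (List.ofFn (conjTuple ι h x).2).prod = MulAut.conj (ι h) (List.ofFn x.2).prod := by
    rw [map_list_prod, List.map_ofFn]
    rfl
  have h2 : (List.ofFn fun i => ((conjTuple ι h x).1 i).1 * ((conjTuple ι h x).1 i).2 *
      ((conjTuple ι h x).1 i).1⁻¹ * ((conjTuple ι h x).1 i).2⁻¹).prod =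
      MulAut.conj h (List.ofFn fun i =>
        (x.1 i).1 * (x.1 i).2 * (x.1 i).1⁻¹ * (x.1 i).2⁻¹).prod := by
    rw [map_list_prod, List.map_ofFn]
    congr 2
    ext1 i
    simp only [conjTuple, Function.comp, MulAut.conj_apply]
    group
  rw [totalProd, h1, h2, totalProd, MulAut.conj_apply, MulAut.conj_apply, map_mul, map_mul,
    map_inv]
  group

theorem totalProd_mem_matrixFunctions (W : Set (Tuples K n g m (GL (Fin n) K))) :
    (fun x : W => totalProd (MonoidHom.id _) x.1) ∈ matrixFunctions (regularFunctions id W) n := by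
  have hr := tupleMatrix_mem_matrixFunctions id W
  have key : ∀ (q : ℕ) (M : Fin q → W → GL (Fin n) K),
      (∀ i, M i ∈ matrixFunctions (regularFunctions id W) n) →
      (fun x => (List.ofFn fun i => M i x).prod) ∈ matrixFunctions (regularFunctions id W) n := by
    intro q M hM
    have : (fun x => (List.ofFn fun i => M i x).prod) = (List.ofFn M).prod := by
      ext1 x
      rw [Pi.list_prod_apply, List.map_ofFn]
      rfl
    rw [this]
    refine Subgroup.list_prod_mem _ fun N hN => ?_
    obtain ⟨i, rfl⟩ := List.mem_ofFn.1 hN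
    exact hM i
  refine Subgroup.mul_mem _ (key g _ fun i => ?_) (key m _ fun j => hr (.inr (.inr j)))
  have hA := hr (.inl i)
  have hB := hr (.inr (.inl i))
  exact Subgroup.mul_mem _ (Subgroup.mul_mem _ (Subgroup.mul_mem _ hA hB)
    (Subgroup.inv_mem _ hA)) (Subgroup.inv_mem _ hB)

/-- If an invariant function separates `V₁` from `V₂`, then the ring of invariants of the union is
the product of the rings of invariants. -/
theorem exists_invariantRing_union_algEquiv (ι : GL (Fin n) K →* H) (c : H → GL (Fin n) K)
    (V₁ V₂ : Set (Tuples K n g m H)) (e : invariantRing ι c (V₁ ∪ V₂))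
    (h₁ : ∀ x : V₁, e.1 ⟨x.1, Or.inl x.2⟩ = 1) (h₂ : ∀ x : V₂, e.1 ⟨x.1, Or.inr x.2⟩ = 0) :
    ∃ E : invariantRing ι c (V₁ ∪ V₂) ≃ₐ[K] invariantRing ι c V₁ × invariantRing ι c V₂,
      (∀ f (x : V₁), (E f).1.1 x = f.1 ⟨x.1, Or.inl x.2⟩) ∧
      ∀ f (x : V₂), (E f).2.1 x = f.1 ⟨x.1, Or.inr x.2⟩ := by
  -- Every regular function on a part extends to the union, since the generating coordinates do. The
  -- extension need not be invariant.
  have lift : ∀ (U : Set (Tuples K n g m H)) (hU : U ⊆ V₁ ∪ V₂), ∀ f ∈ regularFunctions c U,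
      ∃ F ∈ regularFunctions c (V₁ ∪ V₂), ∀ x : U, F ⟨x.1, hU x.2⟩ = f x := by
    intro U hU f hf
    let ρ : (↥(V₁ ∪ V₂) → K) →ₐ[K] (U → K) :=
      AlgHom.pi fun x => Pi.evalAlgHom K (fun _ => K) ⟨x.1, hU x.2⟩
    have : regularFunctions c U ≤ (regularFunctions c (V₁ ∪ V₂)).map ρ := by
      refine Algebra.adjoin_le ?_
      rintro _ ⟨r, a, b, rfl | rfl⟩
      · exact ⟨_, (tupleMatrix_mem_matrixFunctions c (V₁ ∪ V₂) r a b).1, rfl⟩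
      · exact ⟨_, (tupleMatrix_mem_matrixFunctions c (V₁ ∪ V₂) r a b).2, rfl⟩
    obtain ⟨F, hF, rfl⟩ := this hf
    exact ⟨F, hF, fun x => rfl⟩
  have res : ∀ (U : Set (Tuples K n g m H)) (hU : U ⊆ V₁ ∪ V₂),
      ∃ ρ : invariantRing ι c (V₁ ∪ V₂) →ₐ[K] invariantRing ι c U,
        ∀ f x, (ρ f).1 x = f.1 ⟨x.1, hU x.2⟩ := by
    intro U hU
    let ρ : (↥(V₁ ∪ V₂) → K) →ₐ[K] (U → K) :=
      AlgHom.pi fun x => Pi.evalAlgHom K (fun _ => K) ⟨x.1, hU x.2⟩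
    refine ⟨(ρ.comp (invariantRing ι c (V₁ ∪ V₂)).val).codRestrict (invariantRing ι c U)
      fun f => ⟨?_, ?_⟩, fun f x => rfl⟩
    · exact comp_mem_of_tupleMatrix_mem (fun x : U => (⟨x.1, hU x.2⟩ : ↥(V₁ ∪ V₂)))
        (tupleMatrix_mem_matrixFunctions c U) f.1 f.2.1
    · intro h x y hxy
      exact f.2.2 h ⟨x.1, hU x.2⟩ ⟨y.1, hU y.2⟩ hxy
  obtain ⟨ρ₁, hρ₁⟩ := res V₁ Set.subset_union_left
  obtain ⟨ρ₂, hρ₂⟩ := res V₂ Set.subset_union_right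
  refine ⟨AlgEquiv.ofBijective (ρ₁.prod ρ₂) ⟨?_, ?_⟩, fun f x => hρ₁ f x, fun f x => hρ₂ f x⟩
  · intro f f' hff
    have e₁ : ρ₁ f = ρ₁ f' := congrArg Prod.fst hff
    have e₂ : ρ₂ f = ρ₂ f' := congrArg Prod.snd hff
    apply Subtype.ext
    ext ⟨x, hx | hx⟩
    · exact (hρ₁ f ⟨x, hx⟩).symm.trans ((congrArg (fun q => q.1 ⟨x, hx⟩) e₁).trans (hρ₁ f' ⟨x, hx⟩))
    · exact (hρ₂ f ⟨x, hx⟩).symm.trans ((congrArg (fun q => q.1 ⟨x, hx⟩) e₂).trans (hρ₂ f' ⟨x, hx⟩))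
  · rintro ⟨f₁, f₂⟩
    obtain ⟨F₁, hF₁, hf₁⟩ := lift V₁ Set.subset_union_left f₁.1 f₁.2.1
    obtain ⟨F₂, hF₂, hf₂⟩ := lift V₂ Set.subset_union_right f₂.1 f₂.2.1
    have hreg : e.1 * F₁ + (1 - e.1) * F₂ ∈ regularFunctions c (V₁ ∪ V₂) :=
      add_mem (mul_mem e.2.1 hF₁) (mul_mem (sub_mem (one_mem _) e.2.1) hF₂)
    have v₁ : ∀ x : V₁, (e.1 * F₁ + (1 - e.1) * F₂) ⟨x.1, Or.inl x.2⟩ = f₁.1 x := by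
      intro x
      simp [h₁ x, hf₁ x]
    have v₂ : ∀ x : V₂, (e.1 * F₁ + (1 - e.1) * F₂) ⟨x.1, Or.inr x.2⟩ = f₂.1 x := by
      intro x
      simp [h₂ x, hf₂ x]
    -- The glued function depends only on `f₁` and `f₂`, and no orbit meets both parts: the
    -- invariant `e` would take both values `0` and `1` on it.
    have hinv : e.1 * F₁ + (1 - e.1) * F₂ ∈ invariantFunctions ι (V₁ ∪ V₂) := by
      rintro h ⟨x, hx⟩ ⟨y, hy⟩ hxy
      have he := e.2.2 h ⟨x, hx⟩ ⟨y, hy⟩ hxy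
      rcases hx with hx | hx <;> rcases hy with hy | hy
      · rw [v₁ ⟨x, hx⟩, v₁ ⟨y, hy⟩]
        exact f₁.2.2 h ⟨x, hx⟩ ⟨y, hy⟩ hxy
      · rw [h₁ ⟨x, hx⟩, h₂ ⟨y, hy⟩] at he
        exact absurd he zero_ne_one
      · rw [h₂ ⟨x, hx⟩, h₁ ⟨y, hy⟩] at he
        exact absurd he one_ne_zero
      · rw [v₂ ⟨x, hx⟩, v₂ ⟨y, hy⟩]
        exact f₂.2.2 h ⟨x, hx⟩ ⟨y, hy⟩ hxy
    refine ⟨⟨_, hreg, hinv⟩, Prod.ext (Subtype.ext (funext fun x => ?_))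
      (Subtype.ext (funext fun x => ?_))⟩
    · exact (hρ₁ _ x).trans (v₁ x)
    · exact (hρ₂ _ x).trans (v₂ x)

end Tuples

/-! ### The slice `t_0 = 1` in the torus of scalars -/

section Slice

variable {K : Type*} [Field K] {d : ℕ}

/-- The point `t` of `(Kˣ)^(d+2)` with `t₀ = 1`, next coordinates `w`, and last coordinate such
that the alternating product of `t` is `e⁻¹`. -/
def slicePoint (e : Kˣ) (w : Fin d → Kˣ) : Fin (d + 2) → Kˣ :=
  Fin.cons 1 (Fin.snoc w (e * (altProd w)⁻¹) : Fin (d + 1) → Kˣ)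

/-- The coordinates `t_{j+1} / t_0` for `j < d`. -/
def sliceCoord (t : Fin (d + 2) → Kˣ) (i : Fin d) : Kˣ := t i.castSucc.succ * (t 0)⁻¹

theorem sliceCoord_slicePoint (e : Kˣ) (w : Fin d → Kˣ) : sliceCoord (slicePoint e w) = w := by
  ext1 i
  simp [sliceCoord, slicePoint]

theorem altProd_slicePoint (hd : Even d) (e : Kˣ) (w : Fin d → Kˣ) :
    altProd (slicePoint e w) = e⁻¹ := by
  rw [slicePoint, altProd_cons_snoc hd, one_mul, mul_comm e, mul_inv_cancel_left]

/-- Dividing by `t_0` preserves the alternating product because `d + 2` is even; this product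
together with the first `d` ratios then determines the last ratio. -/
theorem mul_slicePoint_sliceCoord (hd : Even d) (t : Fin (d + 2) → Kˣ) (j : Fin (d + 2)) :
    t 0 * slicePoint (altProd t)⁻¹ (sliceCoord t) j = t j := by
  let t' : Fin (d + 2) → Kˣ := Fin.cons 1
    (Fin.snoc (sliceCoord t) (t (Fin.last d).succ * (t 0)⁻¹) : Fin (d + 1) → Kˣ)
  have ht' : t = fun j => t 0 * t' j := by
    ext1 j
    refine Fin.cases ?_ (fun j => ?_) j
    · simp [t']
    · refine Fin.lastCases ?_ (fun i => ?_) j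
      · simp [t', mul_comm (t 0)]
      · simp [t', sliceCoord, mul_comm (t 0)]
  have h : altProd t = (altProd (sliceCoord t) * (t (Fin.last d).succ * (t 0)⁻¹))⁻¹ := by
    rw [ht', altProd_const_mul (by simpa [parity_simps] using hd), altProd_cons_snoc hd, one_mul]
    rw [← ht']
  have : slicePoint (altProd t)⁻¹ (sliceCoord t) = t' := by
    rw [slicePoint, h, inv_inv, mul_comm (altProd _), mul_inv_cancel_right]
  rw [this]
  exact (congrFun ht' j).symm

theorem sliceCoord_const_mul (c : Kˣ) (t : Fin (d + 2) → Kˣ) :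
    sliceCoord (fun j => c * t j) = sliceCoord t := by
  ext1 i
  simp only [sliceCoord, mul_inv_rev]
  rw [mul_comm (t 0)⁻¹, ← mul_assoc, mul_inv_cancel_comm]

theorem slicePoint_mem_unitFunctions {V : Type*} {S : Subalgebra K (V → K)} {e : V → Kˣ}
    (he : e ∈ unitFunctions S) {w : V → Fin d → Kˣ}
    (hw : ∀ i, (fun v => w v i) ∈ unitFunctions S) (j : Fin (d + 2)) :
    (fun v => slicePoint (e v) (w v) j) ∈ unitFunctions S := by
  refine Fin.cases ?_ (fun j => ?_) j
  · exact Subgroup.one_mem _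
  · refine Fin.lastCases ?_ (fun i => ?_) j
    · simp only [slicePoint, Fin.cons_succ, Fin.snoc_last]
      have h1 : (fun v => altProd (w v)) ∈ unitFunctions S := by
        have : (fun v => altProd (w v)) =
            ∏ i : Fin d, (fun v => w v i) ^ ((-1 : ℤ) ^ (i : ℕ)) := by
          ext1 v
          simp [altProd]
        rw [this]
        exact Subgroup.prod_mem _ fun i _ => Subgroup.zpow_mem _ (hw i) _
      exact Subgroup.mul_mem _ he (Subgroup.inv_mem _ h1)
    · simpa [slicePoint] using hw i

theorem sliceCoord_mem_unitFunctions {V : Type*} {S : Subalgebra K (V → K)}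
    {t : V → Fin (d + 2) → Kˣ} (ht : ∀ j, (fun v => t v j) ∈ unitFunctions S) (i : Fin d) :
    (fun v => sliceCoord (t v) i) ∈ unitFunctions S :=
  Subgroup.mul_mem _ (ht _) (Subgroup.inv_mem _ (ht 0))

theorem mem_unitFunctions_inf {V : Type*} {S S' : Subalgebra K (V → K)} {t : V → Kˣ}
    (h : t ∈ unitFunctions S) (h' : t ∈ unitFunctions S') : t ∈ unitFunctions (S ⊓ S') :=
  ⟨⟨h.1, h'.1⟩, ⟨h.2, h'.2⟩⟩

theorem sigmaElt_pow_even (n : ℕ) (hd : Even d) : sigmaElt K n ^ d = 1 := by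
  obtain ⟨r, rfl⟩ := hd
  rw [← two_mul, pow_mul, pow_two, sigmaElt_mul_self, one_pow]

/-- The square appears because `σ` inverts scalars. Thus scalars, which act trivially on `GL_n`, act
on `GL_n σ` and can be used to normalise `t_0`. -/
theorem incl_scale_conj {n : ℕ} (z : Kˣ) (a : GL (Fin n) K) :
    incl K n (scale z 1) * (incl K n a * sigmaElt K n) * (incl K n (scale z 1))⁻¹ =
      incl K n (scale (z * z) a) * sigmaElt K n := by
  rw [incl_conj, scale_inv, inv_one, sigmaAut_scale, map_one, inv_inv, scale_mul, one_mul,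
    scale_mul_scale, mul_one]

theorem scale_one_conj {n : ℕ} (z : Kˣ) (a : GL (Fin n) K) :
    scale z 1 * a * (scale z 1)⁻¹ = a := by
  rw [scale_inv, scale_mul, scale_mul_scale, mul_inv_cancel, scale_one, inv_one, one_mul, mul_one]

end Slice

/-! ### The case `n = 1` -/

section RankOne

universe u

variable {K : Type u} [Field K]

theorem mem_unitFunctions_invariantFunctions {n g m : ℕ} {H : Type u} [Group H] (ι : GL (Fin n) K →* H) {V : Set (Tuples K n g m H)} {t : V → Kˣ}
    (h : ∀ (h : GL (Fin n) K) (x y : V), y.1 = conjTuple ι h x.1 → t y = t x) :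
    t ∈ unitFunctions (invariantFunctions ι V) :=
  ⟨fun g x y e => congrArg Units.val (h g x y e),
    fun g x y e => congrArg (fun z : Kˣ => (z⁻¹ : Kˣ).1) (h g x y e)⟩

theorem eq_scale_det (h : GL (Fin 1) K) : h = scale (Matrix.GeneralLinearGroup.det h) 1 := by
  apply Units.ext
  rw [coe_scale]
  ext i j
  fin_cases i; fin_cases j
  simp

theorem det_scale_one (t : Kˣ) :
    Matrix.GeneralLinearGroup.det (scale t 1 : GL (Fin 1) K) = t := by
  ext
  rw [Matrix.GeneralLinearGroup.val_det_apply, coe_scale]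
  simp

/-- Conjugation multiplies the scalar of an element of `GL_1 σ` by an arbitrary square, that is, by
an arbitrary element of `K^×`. -/
theorem eq_outerComponent [IsAlgClosed K] {C : Set (GLSigma K 1)}
    (hC : IsSemisimpleOuterClass C) : C = outerComponent K 1 := by
  refine (subset_outerComponent hC).antisymm ?_
  obtain ⟨_, ⟨h₀, rfl⟩, -, rfl⟩ := hC
  rintro _ ⟨h, rfl⟩
  obtain ⟨z, hz⟩ := exists_units_sq
    (Matrix.GeneralLinearGroup.det h * (Matrix.GeneralLinearGroup.det h₀)⁻¹)
  refine ⟨scale z 1, ?_⟩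
  rw [incl_scale_conj, hz, eq_scale_det h₀, scale_scale, det_scale_one, inv_mul_cancel_right,
    ← eq_scale_det]

theorem nonempty_ChSigma_one_iso [IsAlgClosed K] (g d : ℕ) (hd : Even d) (N : ℕ)
    (hN : N = g + (g + d)) :
    Nonempty (ChSigma g (fun _ : Fin (d + 2) => outerComponent K 1) ≅ torus K N) := by
  let V := RepSigma g (fun _ : Fin (d + 2) => outerComponent K 1)
  let T : V → Fin (d + 2) → Kˣ := fun x j => Matrix.GeneralLinearGroup.det (x.1.2 j).left
  have hT : ∀ (x : V) j, x.1.2 j = incl K 1 (scale (T x j) 1) * sigmaElt K 1 := by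
    intro x j
    obtain ⟨a, ha⟩ := x.2.1 j
    have : T x j = Matrix.GeneralLinearGroup.det a := by
      change Matrix.GeneralLinearGroup.det (x.1.2 j).left = _
      rw [ha, left_incl_mul_sigmaElt]
    rw [this, ← eq_scale_det, ha]
  have hprod : ∀ (x : Tuples K 1 g (d + 2) (GLSigma K 1)) (t : Fin (d + 2) → Kˣ),
      (∀ j, x.2 j = incl K 1 (scale (t j) 1) * sigmaElt K 1) →
      totalProd (incl K 1) x = incl K 1 (scale (altProd t) 1) := by
    intro x t hx
    have h1 : ∀ A B : GL (Fin 1) K, A * B * A⁻¹ * B⁻¹ = 1 := by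
      intro A B
      rw [eq_scale_det A, scale_one_conj, mul_inv_cancel]
    rw [totalProd]
    simp only [h1]
    have h2 : x.2 = fun j => incl K 1 (scale (t j) 1) * sigmaElt K 1 := funext hx
    rw [h2, prod_incl_scale_mul_sigmaElt t (fun _ => 1) fun _ => map_one _,
      sigmaElt_pow_even 1 (by simpa [parity_simps] using hd)]
    simp
  have haltT : ∀ x : V, altProd (T x) = 1 := by
    intro x
    have h1 : totalProd (incl K 1) x.1 = 1 := x.2.2
    rw [hprod x.1 (T x) (hT x)] at h1
    have := SemidirectProduct.inl_injective (h1.trans (map_one _).symm)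
    rw [← det_scale_one (altProd (T x)), this, map_one]
  let ι := Fin g ⊕ Fin g ⊕ Fin d
  let u : V → ι → Kˣ := fun x i => match i with
    | .inl i => Matrix.GeneralLinearGroup.det (x.1.1 i).1
    | .inr (.inl i) => Matrix.GeneralLinearGroup.det (x.1.1 i).2
    | .inr (.inr i) => sliceCoord (T x) i
  let s₀ : (ι → Kˣ) → Tuples K 1 g (d + 2) (GLSigma K 1) := fun w =>
    (fun i => (scale (w (.inl i)) 1, scale (w (.inr (.inl i))) 1),
      fun j => incl K 1 (scale (slicePoint 1 (fun i => w (.inr (.inr i))) j) 1) * sigmaElt K 1)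
  let s : (ι → Kˣ) → V := fun w => ⟨s₀ w, fun j => ⟨_, rfl⟩, by
    change totalProd _ _ = 1
    rw [hprod _ _ fun j => rfl, altProd_slicePoint hd, inv_one, scale_one, map_one]⟩
  have hTs : ∀ w, T (s w) = slicePoint 1 (fun i => w (.inr (.inr i))) := by
    intro w
    ext1 j
    change Matrix.GeneralLinearGroup.det (incl K 1 _ * sigmaElt K 1).left = _
    rw [left_incl_mul_sigmaElt, det_scale_one]
  have hconjT : ∀ (h : GL (Fin 1) K) (x y : V), y.1 = conjTuple (incl K 1) h x.1 →
      ∃ c, T y = fun j => c * T x j := by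
    intro h x y hxy
    refine ⟨Matrix.GeneralLinearGroup.det h * Matrix.GeneralLinearGroup.det h, ?_⟩
    ext1 j
    have h1 : y.1.2 j = incl K 1 h * x.1.2 j * (incl K 1 h)⁻¹ := congrArg (fun z => z.2 j) hxy
    rw [hT x j, eq_scale_det h, incl_scale_conj, scale_scale] at h1
    change Matrix.GeneralLinearGroup.det (y.1.2 j).left = _
    rw [h1, left_incl_mul_sigmaElt, det_scale_one]
  have hreg := tupleMatrix_mem_matrixFunctions SemidirectProduct.left V
  -- The base of the slice is a single point, with function algebra `K`. The torus coordinates are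
  -- the `A_i`, the `B_i` and the `d` ratios of the scalars of the `X_j`.
  suffices hiso : Nonempty (AddMonoidAlgebra (⊤ : Subalgebra K (Unit → K)) (ι → ℤ) ≃ₐ[K]
      invariantRing (incl K 1) SemidirectProduct.left V) by
    obtain ⟨e⟩ := hiso
    refine specOver_iso_of_algEquiv ?_
    refine e.symm.trans (AlgEquiv.trans (AddMonoidAlgebra.mapAlgEquiv K (ι → ℤ)
      (Subalgebra.topEquiv.trans (AlgEquiv.funUnique K Unit K))) (AddMonoidAlgebra.domCongr K K ?_))
    refine AddEquiv.arrowCongr (Fintype.equivFinOfCardEq ?_) (AddEquiv.refl ℤ)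
    simp [ι, hN]
  refine ⟨(exists_laurent_algEquiv (K := K) (Y := Unit) (V := V) (ι := ι) (O := ⊤) (A := ⊤)
    (B := invariantRing (incl K 1) SemidirectProduct.left V) (fun y y' => y = y')
    (fun a => ⟨fun _ => ⟨trivial, fun y y' h => by rw [h]⟩, fun _ => trivial⟩) (fun _ => ()) u
    (fun _ => s) (fun _ _ => rfl) ?_ ?_ (fun _ _ _ _ _ _ => rfl) ?_ ?_ ?_).choose⟩
  · rintro - w
    ext1 i
    rcases i with i | i | i
    · exact det_scale_one _
    · exact det_scale_one _
    · change sliceCoord (T (s w)) i = _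
      rw [hTs, sliceCoord_slicePoint]
  · intro f hf x
    -- Conjugation by a scalar `z` with `z² = t_0` carries the slice point with the same coordinates
    -- to `x`.
    obtain ⟨z, hz⟩ := exists_units_sq (T x 0)
    refine (hf.2 (scale z 1) (s (u x)) x ?_).symm
    refine Prod.ext (funext fun i => Prod.ext ?_ ?_) (funext fun j => ?_)
    · change _ = scale z 1 * _ * _
      rw [scale_one_conj]
      exact eq_scale_det _
    · change _ = scale z 1 * _ * _
      rw [scale_one_conj]
      exact eq_scale_det _
    · change _ = incl K 1 (scale z 1) * (incl K 1 (scale (slicePoint 1 (sliceCoord (T x)) j) 1) *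
        sigmaElt K 1) * _
      have := mul_slicePoint_sliceCoord hd (T x) j
      rw [haltT, inv_one] at this
      rw [incl_scale_conj, hz, scale_scale, this, hT x j]
  · rintro a -
    exact Subalgebra.algebraMap_mem _ (a ())
  · intro i
    apply mem_unitFunctions_inf
    · rcases i with i | i | i
      · exact det_mem_unitFunctions (hreg (.inl i))
      · exact det_mem_unitFunctions (hreg (.inr (.inl i)))
      · exact sliceCoord_mem_unitFunctions
          (fun j => det_mem_unitFunctions (hreg (.inr (.inr j)))) i
    · apply mem_unitFunctions_invariantFunctions
      intro h x y hxy
      rcases i with i | i | i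
      · change Matrix.GeneralLinearGroup.det (y.1.1 i).1 = _
        rw [hxy]
        change Matrix.GeneralLinearGroup.det (h * _ * h⁻¹) = _
        rw [map_mul, map_mul, map_inv, mul_inv_cancel_comm]
      · change Matrix.GeneralLinearGroup.det (y.1.1 i).2 = _
        rw [hxy]
        change Matrix.GeneralLinearGroup.det (h * _ * h⁻¹) = _
        rw [map_mul, map_mul, map_inv, mul_inv_cancel_comm]
      · change sliceCoord (T y) i = sliceCoord (T x) i
        obtain ⟨c, hc⟩ := hconjT h x y hxy
        rw [hc, sliceCoord_const_mul]
  · intro f hf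
    have hcoord := coord_mem_unitFunctions_range_laurentEval (K := K) (⊤ : Subalgebra K (Unit → K))
      (Prod.fst : Unit × (ι → Kˣ) → Unit) Prod.snd
    refine comp_mem_of_tupleMatrix_mem (fun p : Unit × (ι → Kˣ) => s p.2) ?_ f hf.1
    rintro (i | i | j)
    · exact scale_mem_matrixFunctions (hcoord _) (Subgroup.one_mem _)
    · exact scale_mem_matrixFunctions (hcoord _) (Subgroup.one_mem _)
    · have : (fun p : Unit × (ι → Kˣ) =>
          tupleMatrix SemidirectProduct.left (s p.2).1 (.inr (.inr j))) =
          fun p => scale (slicePoint 1 (fun i => p.2 (.inr (.inr i))) j) 1 := by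
        ext1 p
        exact left_incl_mul_sigmaElt _
      rw [this]
      exact scale_mem_matrixFunctions (slicePoint_mem_unitFunctions (Subgroup.one_mem _)
        (fun i => hcoord _) j) (Subgroup.one_mem _)

end RankOne

/-! ### The case `n = 2`: invariant rings -/

section RankTwo

open Matrix (SpecialLinearGroup)

universe u

variable {K : Type u} [Field K]

theorem det_toGL (s : SpecialLinearGroup (Fin 2) K) :
    Matrix.GeneralLinearGroup.det (s : GL (Fin 2) K) = 1 := by
  ext
  simp

theorem sigmaAut_toGL (s : SpecialLinearGroup (Fin 2) K) :
    sigmaAut K 2 (s : GL (Fin 2) K) = s := by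
  rw [sigmaAut_two, det_toGL, inv_one, scale_one]

/-- Comparing traces gives `t = t'`. This removes the sign ambiguity left by `scale_coe_eq_iff` and
makes the scalar part of an element of `C_j` well defined. -/
theorem scale_coe_injective {t t' : Kˣ} {s s' : SpecialLinearGroup (Fin 2) K}
    (hs : s.1.trace ≠ 0) (htr : s.1.trace = s'.1.trace)
    (h : scale t (s : GL (Fin 2) K) = scale t' (s' : GL (Fin 2) K)) : t = t' ∧ s = s' := by
  have hm : (t : K) • s.1 = (t' : K) • s'.1 := by
    have := congrArg Units.val h
    rwa [coe_scale, coe_scale] at this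
  have ht : t = t' := by
    have := congrArg Matrix.trace hm
    rw [Matrix.trace_smul, Matrix.trace_smul, ← htr] at this
    exact Units.ext (mul_right_cancel₀ hs this)
  refine ⟨ht, Subtype.ext ?_⟩
  rw [ht] at hm
  exact smul_right_injective _ t'.ne_zero hm

/-- An `SL_2`-class is stable under `GL_2`, because every `h` is a scalar times an element of
`SL_2`. -/
theorem CharVar.IsLift.conj_mem [IsAlgClosed K] {C : Set (GLSigma K 2)}
    {C' : Set (SpecialLinearGroup (Fin 2) K)} (hC : IsLift C C') (h : GL (Fin 2) K)
    {s : SpecialLinearGroup (Fin 2) K} (hs : s ∈ C') :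
    ∃ s' ∈ C', (s' : GL (Fin 2) K) = h * s * h⁻¹ := by
  obtain ⟨⟨s₀, rfl⟩, -⟩ := hC
  obtain ⟨v, rfl⟩ := hs
  obtain ⟨z, u, -, rfl⟩ := exists_eq_scale h
  refine ⟨u * (v * s₀ * v⁻¹) * u⁻¹, ⟨u * v, by group⟩, ?_⟩
  rw [coe_conj_eq_conj_scale]

theorem totalProd_incl_scale {g m : ℕ} (hm : Even m)
    (x : Tuples K 2 g m (GLSigma K 2)) (y : Tuples K 2 g m (GL (Fin 2) K)) (t : Fin m → Kˣ)
    (hy : ∀ j, ∃ s : SpecialLinearGroup (Fin 2) K, y.2 j = s)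
    (h₁ : x.1 = y.1) (h₂ : ∀ j, x.2 j = incl K 2 (scale (t j) (y.2 j)) * sigmaElt K 2) :
    totalProd (incl K 2) x = incl K 2 (scale (altProd t) (totalProd (MonoidHom.id _) y)) := by
  have h3 : x.2 = fun j => incl K 2 (scale (t j) (y.2 j)) * sigmaElt K 2 := funext h₂
  rw [totalProd, totalProd, h₁, h3, prod_incl_scale_mul_sigmaElt, sigmaElt_pow_even 2 hm, mul_one,
    ← map_mul, mul_scale]
  · rfl
  · intro j
    obtain ⟨s, hs⟩ := hy j
    rw [hs, sigmaAut_toGL]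

theorem det_totalProd {g m : ℕ} (y : Tuples K 2 g m (GL (Fin 2) K))
    (hy : ∀ j, ∃ s : SpecialLinearGroup (Fin 2) K, y.2 j = s) :
    Matrix.GeneralLinearGroup.det (totalProd (MonoidHom.id _) y) = 1 := by
  rw [totalProd, map_mul, MonoidHom.id_apply, map_list_prod, map_list_prod]
  rw [List.prod_eq_one, List.prod_eq_one, mul_one]
  · intro x hx
    rw [List.map_ofFn, List.mem_ofFn] at hx
    obtain ⟨j, rfl⟩ := hx
    obtain ⟨s, hs⟩ := hy j
    rw [Function.comp, hs, det_toGL]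
  · intro x hx
    rw [List.map_ofFn, List.mem_ofFn] at hx
    obtain ⟨j, rfl⟩ := hx
    simp only [Function.comp, map_mul, map_inv]
    rw [mul_inv_cancel_comm, mul_inv_cancel]

theorem scale_one_inj {a b : Kˣ} (h : (scale a 1 : GL (Fin 2) K) = scale b 1) : a = b := by
  have := congrArg (fun M : GL (Fin 2) K => M.1 0 0) h
  simp only [coe_scale] at this
  ext
  simpa using this

theorem neg_one_eq_scale : (-1 : GL (Fin 2) K) = scale (-1) 1 := by
  apply Units.ext
  rw [coe_scale]
  simp

/-- The tuples in `GL₂` with `X_j ∈ C'_j` and `∏ [A_i, B_i] ∏ X_j = ± 1`. -/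
abbrev RepPM {m : ℕ} (g : ℕ) (C' : Fin m → Set (SpecialLinearGroup (Fin 2) K)) :
    Set (Tuples K 2 g m (GL (Fin 2) K)) :=
  RepGL g (fun j => toGLSet (C' j)) 1 ∪ RepGL g (fun j => toGLSet (C' j)) (-1)

/-- The sign of `∏ [A_i, B_i] ∏ X_j`. -/
theorem exists_sign {m : ℕ} (g : ℕ) (C' : Fin m → Set (SpecialLinearGroup (Fin 2) K)) :
    ∃ e : RepPM g C' → Kˣ, (∀ y, totalProd (MonoidHom.id _) y.1 = scale (e y) 1) ∧
      (∀ y, e y * e y = 1) ∧ (∀ y, y.1 ∈ RepGL g (fun j => toGLSet (C' j)) 1 → e y = 1) ∧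
      (∀ y, y.1 ∈ RepGL g (fun j => toGLSet (C' j)) (-1) → e y = -1) ∧
      e ∈ unitFunctions (regularFunctions id (RepPM g C')) ∧
      ∀ h (y y' : RepPM g C'), y'.1 = conjTuple (MonoidHom.id _) h y.1 → e y' = e y := by
  have h1 : ∀ y : RepPM g C', ∃ e : Kˣ, totalProd (MonoidHom.id _) y.1 = scale e 1 ∧ e * e = 1 := by
    rintro ⟨y, hy | hy⟩
    · exact ⟨1, hy.2.trans (scale_one 1).symm, one_mul 1⟩
    · exact ⟨-1, hy.2.trans neg_one_eq_scale, by simp⟩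
  choose e he he2 using h1
  refine ⟨e, he, he2, ?_, ?_, ?_, ?_⟩
  · intro y hy
    apply scale_one_inj
    rw [← he, scale_one]
    exact hy.2
  · intro y hy
    apply scale_one_inj
    rw [← he, ← neg_one_eq_scale]
    exact hy.2
  -- The sign is the upper left entry of the total product, hence regular.
  · have h := totalProd_mem_matrixFunctions (RepPM g C') 0 0
    simp only [he, scale_inv, coe_scale, inv_one] at h
    exact ⟨by simpa using h.1, by simpa using h.2⟩
  · intro h y y' hy
    apply scale_one_inj
    rw [← he, hy, totalProd_conjTuple, he y]
    simp only [MonoidHom.id_apply]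
    rw [mul_scale, scale_mul, mul_one, mul_inv_cancel]

theorem exists_invariantRing_RepPM_algEquiv (hchar : (2 : K) ≠ 0) {m : ℕ} (g : ℕ)
    (C' : Fin m → Set (SpecialLinearGroup (Fin 2) K)) :
    ∃ E : invariantRing (MonoidHom.id _) id (RepPM g C') ≃ₐ[K]
        invariantRing (MonoidHom.id _) id (RepGL g (fun j => toGLSet (C' j)) 1) ×
        invariantRing (MonoidHom.id _) id (RepGL g (fun j => toGLSet (C' j)) (-1)),
      (∀ f x, (E f).1.1 x = f.1 ⟨x.1, Or.inl x.2⟩) ∧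
      ∀ f x, (E f).2.1 x = f.1 ⟨x.1, Or.inr x.2⟩ := by
  obtain ⟨e, -, -, he₁, he₂, hreg, hinv⟩ := exists_sign g C'
  -- The idempotent that is `1` on `Rep^+` and `0` on `Rep^-`.
  have hmem : (fun y => ((e y : K) + 1) * 2⁻¹) ∈
      invariantRing (MonoidHom.id _) id (RepPM g C') := by
    constructor
    · exact mul_mem (add_mem hreg.1 (Subalgebra.algebraMap_mem _ (1 : K)))
        (Subalgebra.algebraMap_mem _ (2⁻¹ : K))
    · intro h x y hxy
      dsimp only
      rw [hinv h x y hxy]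
  refine exists_invariantRing_union_algEquiv _ _ _ _ ⟨_, hmem⟩ (fun x => ?_) (fun x => ?_)
  · dsimp only
    rw [he₁ _ x.2, Units.val_one, one_add_one_eq_two, mul_inv_cancel₀ hchar]
  · dsimp only
    rw [he₂ _ x.2]
    simp

/-- The criterion `exists_laurent_algEquiv` applies with `π` replacing each `t_j s_j σ` by `s_j`,
and with `s` putting back the scalars of the slice point whose alternating product is the inverse of
the sign. The clause on points holds because the `s_j` are unique. -/
theorem exists_laurent_algEquiv_invariantRing [IsAlgClosed K] {g d : ℕ}
    (hd : Even d) (C : Fin (d + 2) → Set (GLSigma K 2)) (hC : ∀ j, C j ⊆ outerComponent K 2)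
    (C' : Fin (d + 2) → Set (SpecialLinearGroup (Fin 2) K)) (hlift : ∀ j, IsLift (C j) (C' j))
    (htr : ∀ j, ∀ s ∈ C' j, s.1.trace ≠ 0) :
    ∃ e : AddMonoidAlgebra (invariantRing (MonoidHom.id _) id (RepPM g C')) (Fin d → ℤ) ≃ₐ[K]
        invariantRing (incl K 2) SemidirectProduct.left (RepSigma g C),
      ∀ a (x : RepSigma g C) (y : RepPM g C') (t : Fin (d + 2) → Kˣ),
        (x.1.1 = y.1.1 ∧ ∀ j, x.1.2 j = incl K 2 (scale (t j) (y.1.2 j)) * sigmaElt K 2) →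
        (e (.single 0 a)).1 x = a.1 y := by
  have hd2 : Even (d + 2) := by simpa [parity_simps] using hd
  have hSL : ∀ (y : RepPM g C') j, ∃ s ∈ C' j, (s : GL (Fin 2) K) = y.1.2 j := by
    rintro ⟨y, hy | hy⟩ j <;> exact hy.1 j
  have h1 : ∀ (x : RepSigma g C) j, ∃ (t : Kˣ) (s : SpecialLinearGroup (Fin 2) K), s ∈ C' j ∧
      x.1.2 j = incl K 2 (scale t (s : GL (Fin 2) K)) * sigmaElt K 2 :=
    fun x j => (hlift j).exists_eq (hC j) (x.2.1 j)
  choose T S hS hTS using h1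
  have huniq : ∀ (x : RepSigma g C) j (t : Kˣ), ∀ s ∈ C' j,
      x.1.2 j = incl K 2 (scale t (s : GL (Fin 2) K)) * sigmaElt K 2 → T x j = t ∧ S x j = s := by
    intro x j t s hs hx
    exact scale_coe_injective (htr j _ (hS x j)) ((hlift j).trace_eq (hS x j) hs)
      (incl_mul_sigmaElt_injective ((hTS x j).symm.trans hx))
  have hconj : ∀ (h : GL (Fin 2) K) (x x' : RepSigma g C), x'.1 = conjTuple (incl K 2) h x.1 →
      ∀ j, T x' j = Matrix.GeneralLinearGroup.det h * T x j ∧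
        (S x' j : GL (Fin 2) K) = h * S x j * h⁻¹ := by
    intro h x x' hx j
    obtain ⟨s', hs', hss⟩ := (hlift j).conj_mem h (hS x j)
    obtain ⟨e1, e2⟩ := huniq x' j (Matrix.GeneralLinearGroup.det h * T x j) s' hs' (by
      have h2 : x'.1.2 j = incl K 2 h * x.1.2 j * (incl K 2 h)⁻¹ := congrArg (fun z => z.2 j) hx
      rw [h2, hTS, incl_conj_two, hss, mul_scale, scale_mul, scale_scale])
    exact ⟨e1, by rw [e2, hss]⟩
  have hPsq : ∀ (x : RepSigma g C), scale (altProd (T x)) (totalProd (MonoidHom.id _)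
      ((x.1.1, fun j => (S x j : GL (Fin 2) K)) : Tuples K 2 g (d + 2) (GL (Fin 2) K))) = 1 := by
    intro x
    have h2 := totalProd_incl_scale hd2 x.1 (x.1.1, fun j => (S x j : GL (Fin 2) K)) (T x)
      (fun j => ⟨_, rfl⟩) rfl (hTS x)
    have h3 : totalProd (incl K 2) x.1 = 1 := x.2.2
    rw [h3] at h2
    exact (SemidirectProduct.inl_injective ((map_one _).trans h2)).symm
  have hπmem : ∀ x : RepSigma g C, ((x.1.1, fun j => (S x j : GL (Fin 2) K)) :
      Tuples K 2 g (d + 2) (GL (Fin 2) K)) ∈ RepPM g C' := by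
    intro x
    have h2 := hPsq x
    -- Commutators and the `s_j` have determinant `1`, so the alternating product of the `t_j`
    -- squares to `1`.
    have h3 := congrArg Matrix.GeneralLinearGroup.det h2
    rw [det_scale_two, det_totalProd _ (fun j => ⟨_, rfl⟩), mul_one, map_one] at h3
    have h4 : (altProd (T x) : K) * altProd (T x) = 1 := congrArg Units.val h3
    rcases mul_self_eq_one_iff.1 h4 with h5 | h5
    · left
      have : altProd (T x) = 1 := Units.ext h5
      rw [this, scale_one] at h2
      exact ⟨fun j => ⟨_, hS x j, rfl⟩, h2⟩
    · right
      have : altProd (T x) = -1 := Units.ext h5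
      refine ⟨fun j => ⟨_, hS x j, rfl⟩, ?_⟩
      rw [neg_one_eq_scale, ← h2, this, scale_scale, neg_mul_neg, one_mul, scale_one]
      rfl
  let π : RepSigma g C → RepPM g C' := fun x => ⟨_, hπmem x⟩
  obtain ⟨ε, hε, hε2, -, -, hεreg, hεinv⟩ := exists_sign g C'
  have hεπ : ∀ x, (altProd (T x))⁻¹ = ε (π x) := by
    intro x
    have h2 := hPsq x
    have h3 := hε (π x)
    change totalProd (MonoidHom.id _) (x.1.1, fun j => (S x j : GL (Fin 2) K)) = _ at h3
    rw [h3, scale_scale, ← scale_one (1 : GL (Fin 2) K), scale_scale, mul_one] at h2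
    exact inv_eq_of_mul_eq_one_right (scale_one_inj h2)
  let s₀ : RepPM g C' → (Fin d → Kˣ) → Tuples K 2 g (d + 2) (GLSigma K 2) := fun y w =>
    (y.1.1, fun j => incl K 2 (scale (slicePoint (ε y) w j) (y.1.2 j)) * sigmaElt K 2)
  have hs₀ : ∀ y w, s₀ y w ∈ RepSigma g C := by
    intro y w
    refine ⟨fun j => ?_, ?_⟩
    · obtain ⟨s, hs, hsy⟩ := hSL y j
      change incl K 2 (scale _ (y.1.2 j)) * sigmaElt K 2 ∈ _
      rw [← hsy]
      exact (hlift j).scale_mem hs _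
    · refine (totalProd_incl_scale hd2 (s₀ y w) y.1 (slicePoint (ε y) w)
        (fun j => ?_) rfl fun j => rfl).trans ?_
      · obtain ⟨s, hs, hsy⟩ := hSL y j
        exact ⟨s, hsy.symm⟩
      · rw [altProd_slicePoint hd, hε, scale_scale, inv_mul_cancel, scale_one, map_one]
  let s : RepPM g C' → (Fin d → Kˣ) → RepSigma g C := fun y w => ⟨s₀ y w, hs₀ y w⟩
  have hTs : ∀ y w j, T (s y w) j = slicePoint (ε y) w j ∧
      (S (s y w) j : GL (Fin 2) K) = y.1.2 j := by
    intro y w j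
    obtain ⟨s', hs', hsy⟩ := hSL y j
    obtain ⟨e1, e2⟩ := huniq (s y w) j (slicePoint (ε y) w j) s' hs' (by rw [hsy])
    exact ⟨e1, by rw [e2, hsy]⟩
  have hreg := tupleMatrix_mem_matrixFunctions SemidirectProduct.left (RepSigma g C)
  have hXleft : ∀ (x : RepSigma g C) j, (x.1.2 j).left = scale (T x j) (S x j) := by
    intro x j
    rw [hTS, left_incl_mul_sigmaElt]
  have hTreg : ∀ j, (fun x => T x j) ∈
      unitFunctions (regularFunctions SemidirectProduct.left (RepSigma g C)) := by
    intro j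
    -- Regularity of the scalar parts: `t_j` is the trace of the matrix of `X_j` divided by `τ`, and
    -- `t_j⁻¹ = t_j / det` because that matrix has determinant `t_j²`.
    have hτ : ∃ τ : K, τ ≠ 0 ∧ ∀ s ∈ C' j, s.1.trace = τ := by
      obtain ⟨⟨s₁, hs₁⟩, -⟩ := hlift j
      have hmem : s₁ ∈ C' j := by rw [hs₁]; exact ⟨1, by group⟩
      exact ⟨s₁.1.trace, htr j _ hmem, fun s hs => (hlift j).trace_eq hs hmem⟩
    obtain ⟨τ, hτ0, hτ⟩ := hτ
    have h2 : (fun x => (T x j : K)) ∈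
        regularFunctions SemidirectProduct.left (RepSigma g C) := by
      have : (fun x => (T x j : K)) =
          (fun x : RepSigma g C => (tupleMatrix SemidirectProduct.left x.1 (.inr (.inr j))).1.trace) *
            fun _ => τ⁻¹ := by
        ext x
        change _ = ((x.1.2 j).left).1.trace * τ⁻¹
        rw [hXleft, coe_scale, Matrix.trace_smul, smul_eq_mul]
        have h3 : ((S x j : GL (Fin 2) K) : Matrix (Fin 2) (Fin 2) K).trace = τ := hτ _ (hS x j)
        rw [h3, mul_inv_cancel_right₀ hτ0]
      rw [this]
      exact mul_mem (trace_mem_of_mem_matrixFunctions (hreg _)) (Subalgebra.algebraMap_mem _ τ⁻¹)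
    refine ⟨h2, ?_⟩
    have : (fun x => (((T x j)⁻¹ : Kˣ) : K)) = (fun x => (T x j : K)) *
        fun x : RepSigma g C => (((Matrix.GeneralLinearGroup.det
          (tupleMatrix SemidirectProduct.left x.1 (.inr (.inr j))))⁻¹ : Kˣ) : K) := by
      ext x
      change _ = (T x j : K) * (((Matrix.GeneralLinearGroup.det (x.1.2 j).left)⁻¹ : Kˣ) : K)
      rw [hXleft, det_scale_two, det_toGL, mul_one, mul_inv, ← Units.val_mul, mul_inv_cancel_left]
    rw [this]
    exact mul_mem h2 (det_mem_unitFunctions (hreg _)).2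
  obtain ⟨e, he⟩ := exists_laurent_algEquiv (K := K) (V := RepSigma g C) (ι := Fin d)
    (O := regularFunctions id (RepPM g C'))
    (A := invariantRing (MonoidHom.id _) id (RepPM g C'))
    (B := invariantRing (incl K 2) SemidirectProduct.left (RepSigma g C))
    (fun y y' => ∃ h, y'.1 = conjTuple (MonoidHom.id _) h y.1)
    (fun a => ⟨fun ha => ⟨ha.1, fun y y' ⟨h, hy⟩ => ha.2 h y y' hy⟩,
      fun ha => ⟨ha.1, fun h y y' hy => ha.2 y y' ⟨h, hy⟩⟩⟩)
    π (fun x => sliceCoord (T x)) s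
    (fun y w => Subtype.ext (Prod.ext rfl (funext fun j => (hTs y w j).2)))
    (fun y w => by rw [funext fun j => (hTs y w j).1, sliceCoord_slicePoint])
    (by
      intro f hf x
      obtain ⟨z, hz⟩ := exists_units_sq (T x 0)
      refine (hf.2 (scale z 1) _ x ?_).symm
      refine Prod.ext (funext fun i => Prod.ext ?_ ?_) (funext fun j => ?_)
      · exact (scale_one_conj _ _).symm
      · exact (scale_one_conj _ _).symm
      · change _ = incl K 2 (scale z 1) * (incl K 2 (scale (slicePoint (ε (π x))
          (sliceCoord (T x)) j) (S x j)) * sigmaElt K 2) * _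
        rw [incl_scale_conj, hz, scale_scale, ← hεπ, mul_slicePoint_sliceCoord hd, hTS])
    (by
      rintro f hf y y' w ⟨h, hy⟩
      -- The element `z h` has determinant `1` and conjugates matrices as `h` does, so it moves the
      -- base point without changing the scalars and stays in the slice.
      obtain ⟨z, hz⟩ := exists_units_sq (Matrix.GeneralLinearGroup.det h)⁻¹
      refine hf.2 (scale z 1 * h) _ _ ?_
      have hc : ∀ a : GL (Fin 2) K, (scale z 1 * h) * a * (scale z 1 * h)⁻¹ = h * a * h⁻¹ := by
        intro a
        rw [mul_inv_rev, ← mul_assoc, mul_assoc (scale z 1), mul_assoc (scale z 1),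
          scale_one_conj]
      refine Prod.ext (funext fun i => Prod.ext ?_ ?_) (funext fun j => ?_)
      · refine Eq.trans ?_ (hc _).symm
        exact congrArg (fun q => (q.1 i).1) hy
      · refine Eq.trans ?_ (hc _).symm
        exact congrArg (fun q => (q.1 i).2) hy
      · change incl K 2 (scale (slicePoint (ε y') w j) (y'.1.2 j)) * sigmaElt K 2 =
          incl K 2 (scale z 1 * h) * (incl K 2 (scale (slicePoint (ε y) w j) (y.1.2 j)) *
            sigmaElt K 2) * _
        have h3 : y'.1.2 j = h * y.1.2 j * h⁻¹ := congrArg (fun q => q.2 j) hy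
        rw [incl_conj_two, hc, map_mul, det_scale_two, map_one, mul_one, hz, inv_mul_cancel,
          scale_one, h3, hεinv h y y' hy, mul_scale, scale_mul])
    (by
      intro a ha
      constructor
      · refine comp_mem_of_tupleMatrix_mem π ?_ a ha.1
        rintro (i | i | j)
        · exact hreg (.inl i)
        · exact hreg (.inr (.inl i))
        · have : (fun x => tupleMatrix id (π x).1 (.inr (.inr j))) = fun x : RepSigma g C =>
              scale (T x j)⁻¹ (tupleMatrix SemidirectProduct.left x.1 (.inr (.inr j))) := by
            ext1 x
            change (S x j : GL (Fin 2) K) = scale _ (x.1.2 j).left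
            rw [hXleft, scale_scale, inv_mul_cancel, scale_one]
          rw [this]
          exact scale_mem_matrixFunctions (Subgroup.inv_mem _ (hTreg j)) (hreg _)
      · intro h x x' hx
        refine ha.2 h (π x) (π x') (Prod.ext ?_ (funext fun j => (hconj h x x' hx j).2))
        exact (congrArg Prod.fst hx :))
    (by
      intro i
      refine mem_unitFunctions_inf (sliceCoord_mem_unitFunctions hTreg i)
        (mem_unitFunctions_invariantFunctions _ ?_)
      intro h x x' hx
      have : T x' = fun j => Matrix.GeneralLinearGroup.det h * T x j :=
        funext fun j => (hconj h x x' hx j).1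
      rw [this, sliceCoord_const_mul])
    (by
      intro f hf
      -- On the slice the matrix of `X_j` is a Laurent monomial in `w`, times possibly the regular
      -- sign, times the matrix at the base point. So regular functions restrict to Laurent
      -- polynomials over `O`.
      have hO : ∀ a ∈ regularFunctions id (RepPM g C'), _ := fun a ha =>
        comp_mem_range_laurentEval (K := K) (Prod.fst : RepPM g C' × (Fin d → Kˣ) → RepPM g C')
          Prod.snd ha
      have hcoord := coord_mem_unitFunctions_range_laurentEval (K := K)
        (regularFunctions id (RepPM g C'))
        (Prod.fst : RepPM g C' × (Fin d → Kˣ) → RepPM g C') Prod.snd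
      have hY := fun r => comp_mem_matrixFunctions
        (Prod.fst : RepPM g C' × (Fin d → Kˣ) → RepPM g C') hO
        (tupleMatrix_mem_matrixFunctions id (RepPM g C') r)
      refine comp_mem_of_tupleMatrix_mem
        (fun p : RepPM g C' × (Fin d → Kˣ) => s p.1 p.2) ?_ f hf.1
      rintro (i | i | j)
      · exact hY (.inl i)
      · exact hY (.inr (.inl i))
      · have : (fun p : RepPM g C' × (Fin d → Kˣ) =>
            tupleMatrix SemidirectProduct.left (s p.1 p.2).1 (.inr (.inr j))) =
            fun p => scale (slicePoint (ε p.1) p.2 j) (tupleMatrix id p.1.1 (.inr (.inr j))) := by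
          ext1 p
          exact left_incl_mul_sigmaElt _
        rw [this]
        exact scale_mem_matrixFunctions (slicePoint_mem_unitFunctions
          (comp_mem_unitFunctions _ hO hεreg) hcoord j) (hY _))
  refine ⟨e, fun a x y t hxy => (he a x).trans (congrArg a.1 ?_)⟩
  refine Subtype.ext (Prod.ext hxy.1 (funext fun j => ?_))
  obtain ⟨s', hs', hsy⟩ := hSL y j
  have := huniq x j (t j) s' hs' (by rw [hsy]; exact hxy.2 j)
  change (S x j : GL (Fin 2) K) = _
  rw [this.2, hsy]

end RankTwo

/-! ### From invariant rings to schemes, and the theorem -/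

section Main

universe u

variable {K : Type u} [Field K]

open TensorProduct in
theorem exists_tensor_algEquiv {R A B : Type*} [CommRing R] [Algebra K R]
    [CommRing A] [Algebra K A] [CommRing B] [Algebra K B] {M : Type*} [AddCommMonoid M]
    (E : A ≃ₐ[K] R) (e : AddMonoidAlgebra A M ≃ₐ[K] B) :
    ∃ ψ : R ⊗[K] AddMonoidAlgebra K M ≃ₐ[K] B, ∀ a, ψ (E a ⊗ₜ 1) = e (.single 0 a) := by
  refine ⟨((AddMonoidAlgebra.scalarTensorEquiv (M := M) K R).restrictScalars K).trans
    ((AddMonoidAlgebra.mapAlgEquiv K M E.symm).trans e), fun a => ?_⟩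
  simp [AddMonoidAlgebra.one_def]

/-- As `coprodSpec` is an isomorphism, equality of points of the disjoint union can be tested in the
affine scheme `Spec (R₁ × R₂)`, where it is an identity of ring homomorphisms. -/
theorem comp_eq_comp_of_comp_coprodSpec_eq {R₁ R₂ : Type u} [CommRing R₁] [CommRing R₂]
    {W X P Z : Scheme.{u}} {f : W ⟶ X} {i : X ⟶ P} {π : P ⟶ Spec (.of R₁) ⨿ Spec (.of R₂)}
    (p : W ⟶ Z) (j : Z ⟶ Spec (.of R₁) ⨿ Spec (.of R₂))
    (h : f ≫ i ≫ π ≫ coprodSpec R₁ R₂ = p ≫ j ≫ coprodSpec R₁ R₂) : f ≫ i ≫ π = p ≫ j := by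
  rw [← cancel_mono (coprodSpec R₁ R₂)]
  simpa using h

/-- If `B` is the Laurent polynomial algebra over `R₁ × R₂`, then `Spec B` is the product of
`Spec R₁ ⊔ Spec R₂` and a torus, and the projection to the first factor is the evident one on
`K`-points. -/
theorem exists_prodOver_torus_iso {R₁ R₂ A B : Type u} [CommRing R₁] [Algebra K R₁] [CommRing R₂]
    [Algebra K R₂] [CommRing A] [Algebra K A] [CommRing B] [Algebra K B] {d : ℕ}
    (E : A ≃ₐ[K] R₁ × R₂) (e : AddMonoidAlgebra A (Fin d → ℤ) ≃ₐ[K] B) :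
    ∃ Φ : prodOver (sumOver (specOver K R₁) (specOver K R₂)) (torus K d) ≅ specOver K B,
      (∀ (q : B →+* K) (p : R₁ →+* K), (∀ a, q (e (.single 0 a)) = p (E a).1) →
        Spec.map (CommRingCat.ofHom q) ≫ Φ.inv.left ≫ pullback.fst _ _ =
          Spec.map (CommRingCat.ofHom p) ≫ coprod.inl) ∧
      (∀ (q : B →+* K) (p : R₂ →+* K), (∀ a, q (e (.single 0 a)) = p (E a).2) →
        Spec.map (CommRingCat.ofHom q) ≫ Φ.inv.left ≫ pullback.fst _ _ =
          Spec.map (CommRingCat.ofHom p) ≫ coprod.inr) := by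
  obtain ⟨ψ, hψ⟩ := exists_tensor_algEquiv E e
  obtain ⟨Φ, hΦ⟩ := exists_prodOver_sumOver_iso ψ
  refine ⟨Φ, fun q p h => ?_, fun q p h => ?_⟩
  · refine comp_eq_comp_of_comp_coprodSpec_eq _ _ ?_
    refine (congrArg (Spec.map (CommRingCat.ofHom q) ≫ ·) hΦ).trans ?_
    refine Eq.trans ?_ (congrArg (Spec.map (CommRingCat.ofHom p) ≫ ·)
      (coprodSpec_inl R₁ R₂)).symm
    rw [← Spec.map_comp, ← Spec.map_comp]
    congr 1
    ext r
    obtain ⟨a, rfl⟩ := E.surjective r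
    exact (congrArg q (hψ a)).trans (h a)
  · refine comp_eq_comp_of_comp_coprodSpec_eq _ _ ?_
    refine (congrArg (Spec.map (CommRingCat.ofHom q) ≫ ·) hΦ).trans ?_
    refine Eq.trans ?_ (congrArg (Spec.map (CommRingCat.ofHom p) ≫ ·)
      (coprodSpec_inr R₁ R₂)).symm
    rw [← Spec.map_comp, ← Spec.map_comp]
    congr 1
    ext r
    obtain ⟨a, rfl⟩ := E.surjective r
    exact (congrArg q (hψ a)).trans (h a)

theorem exists_ChSigma_two_iso [IsAlgClosed K] (hchar : (2 : K) ≠ 0) {g d : ℕ}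
    (hd : Even d) (C : Fin (d + 2) → Set (GLSigma K 2)) (hC : ∀ j, C j ⊆ outerComponent K 2)
    (C' : Fin (d + 2) → Set (Matrix.SpecialLinearGroup (Fin 2) K))
    (hlift : ∀ j, IsLift (C j) (C' j)) (htr : ∀ j, ∀ s ∈ C' j, s.1.trace ≠ 0) :
    ∃ Φ : prodOver
          (sumOver (ChGL g (fun j => toGLSet (C' j)) 1) (ChGL g (fun j => toGLSet (C' j)) (-1)))
          (torus K d) ≅ ChSigma g C,
      (∀ (x : RepSigma g C) (y : RepGL g (fun j => toGLSet (C' j)) 1) (t : Fin (d + 2) → Kˣ),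
        (x.1.1 = y.1.1 ∧ ∀ j, x.1.2 j = incl K 2 (scale (t j) (y.1.2 j)) * sigmaElt K 2) →
        ChSigma.point x ≫ Φ.inv.left ≫ pullback.fst _ _ = ChGL.point y ≫ coprod.inl) ∧
      (∀ (x : RepSigma g C) (y : RepGL g (fun j => toGLSet (C' j)) (-1)) (t : Fin (d + 2) → Kˣ),
        (x.1.1 = y.1.1 ∧ ∀ j, x.1.2 j = incl K 2 (scale (t j) (y.1.2 j)) * sigmaElt K 2) →
        ChSigma.point x ≫ Φ.inv.left ≫ pullback.fst _ _ = ChGL.point y ≫ coprod.inr) := by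
  obtain ⟨e, he⟩ := exists_laurent_algEquiv_invariantRing (g := g) hd C hC C' hlift htr
  obtain ⟨E, hE₁, hE₂⟩ := exists_invariantRing_RepPM_algEquiv hchar g C'
  obtain ⟨Φ, h₁, h₂⟩ := exists_prodOver_torus_iso E e
  refine ⟨Φ, fun x y t hxy => h₁ _ _ fun a => ?_, fun x y t hxy => h₂ _ _ fun a => ?_⟩
  · exact (he a x ⟨y.1, Or.inl y.2⟩ t hxy).trans (hE₁ a y).symm
  · exact (he a x ⟨y.1, Or.inr y.2⟩ t hxy).trans (hE₂ a y).symm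

end Main

theorem mainTheorem5 {K : Type*} [Field K] [IsAlgClosed K] (hchar : (2 : K) ≠ 0)
    (g k : ℕ) (hk : 0 < k) :
    -- the case `n = 2`
    (∀ C : Fin (2 * k) → Set (GLSigma K 2),
      (∀ j, IsSemisimpleOuterClass (C j)) →
      (∀ (j : Fin (2 * k)) (a : Kˣ),
        incl K 2 (Matrix.SpecialLinearGroup.toGL (diagSL a)) * sigmaElt K 2 ∈ C j →
          (a : K) ^ 2 ≠ -1) →
      (∃ C' : Fin (2 * k) → Set (Matrix.SpecialLinearGroup (Fin 2) K), ∀ j, IsLift (C j) (C' j)) ∧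
      ∀ C' : Fin (2 * k) → Set (Matrix.SpecialLinearGroup (Fin 2) K),
        (∀ j, IsLift (C j) (C' j)) →
        (∀ j, Disjoint {s | s ∈ C' j} {s | -s ∈ C' j}) ∧
        ∃ Φ : prodOver
              (sumOver (ChGL g (fun j => toGLSet (C' j)) 1) (ChGL g (fun j => toGLSet (C' j)) (-1)))
              (torus K (2 * k - 2)) ≅ ChSigma g C,
          (∀ (x : RepSigma g C) (y : RepGL g (fun j => toGLSet (C' j)) 1) (t : Fin (2 * k) → Kˣ),
            (x.1.1 = y.1.1 ∧ ∀ j, x.1.2 j = incl K 2 (scale (t j) (y.1.2 j)) * sigmaElt K 2) →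
            ChSigma.point x ≫ Φ.inv.left ≫ pullback.fst _ _ = ChGL.point y ≫ coprod.inl) ∧
          (∀ (x : RepSigma g C) (y : RepGL g (fun j => toGLSet (C' j)) (-1)) (t : Fin (2 * k) → Kˣ),
            (x.1.1 = y.1.1 ∧ ∀ j, x.1.2 j = incl K 2 (scale (t j) (y.1.2 j)) * sigmaElt K 2) →
            ChSigma.point x ≫ Φ.inv.left ≫ pullback.fst _ _ = ChGL.point y ≫ coprod.inr)) ∧
    -- the case `n = 1`
    (∀ C : Fin (2 * k) → Set (GLSigma K 1),
      (∀ j, IsSemisimpleOuterClass (C j)) →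
      (∀ j, C j = outerComponent K 1) ∧
      Nonempty (ChSigma g C ≅ torus K (2 * (g + k - 1)))) := by
  -- Of the `2k` scalars, the first is normalised and the last is determined by the relation; `d`
  -- counts the remaining free ones.
  obtain ⟨d, hd, hkd⟩ : ∃ d, Even d ∧ 2 * k = d + 2 := ⟨2 * (k - 1), even_two_mul _, by omega⟩
  have hd' : 2 * k - 2 = d := by omega
  have hN : 2 * (g + k - 1) = g + (g + d) := by omega
  rw [hd']
  clear hd'
  generalize 2 * (g + k - 1) = N at hN
  generalize 2 * k = m at hkd
  subst hkd
  refine ⟨fun C hC hdiag => ⟨?_, fun C' hlift => ⟨fun j => ?_, ?_⟩⟩, fun C hC => ?_⟩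
  · choose C' hC' using fun j => exists_isLift (hC j)
    exact ⟨C', hC'⟩
  · exact (hlift j).disjoint hchar (hdiag j)
  · exact exists_ChSigma_two_iso hchar hd C (fun j => subset_outerComponent (hC j)) C' hlift
      fun j s hs => (hlift j).trace_ne_zero hchar (hdiag j) hs
  · have hC' : C = fun _ => outerComponent K 1 := funext fun j => eq_outerComponent (hC j)
    exact ⟨fun j => eq_outerComponent (hC j), hC' ▸ nonempty_ChSigma_one_iso g d hd N hN⟩
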